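/- Let $N\ge 1$. For $\gamma\in\mathbb R$ let $d\nu_\gamma(x,y)=|x-y|^{\gamma-N}\,dx\,dy$ on $\{(x,y)\in\mathbb R^N\times\mathbb R^N: x\ne y\}$. For measurable $u:\mathbb R^N\to\mathbb R$ and $\lambda>0$ put $$E_{\lambda,\gamma}[u]=\Big\{(x,y)\in\mathbb R^N\times\mathbb R^N:\ x\neq y,\ \frac{|u(x)-u(y)|}{|x-y|^{1+\gamma}}>\lambda\Big\}.$$ Let $\kappa(1,N)=\int_{\mathbb S^{N-1}}|e\cdot\omega|\,d\omega$, where $e$ is any unit vector of $\mathbb R^N$ (for $N=1$, $d\omega$ is counting measure on $\{\pm1\}$). For $u\in L^1_{\rm loc}(\mathbb R^N)$ let $$\|\nabla u\|_{\mathcal M}=\sup\Big\{\Big|\int_{\mathbb R^N}u\,\mathrm{div}\,\phi\,dx\Big|:\ \phi\in C^1_c(\mathbb R^N,\mathbb R^N),\ \|\phi\|_\infty\le1\Big\},$$ and let $\dot{BV}(\mathbb R^N)$ be the set of $u\in L^1_{\rm loc}(\mathbb R^N)$ with $\|\nabla u\|_{\mathcal M}<\infty$. (i) For every $\gamma>0$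 there is $u\in\dot{BV}(\mathbb R^N)$ for which $$\lim_{\lambda\to\infty}\lambda\,\nu_\gamma(E_{\lambda,\gamma}[u])=\frac{\kappa(1,N)}{|\gamma|}\|\nabla u\|_{\mathcal M}$$ fails (the limit does not exist in $[0,\infty]$, or it has a different value). For every $\gamma<0$ there is $u\in\dot{BV}(\mathbb R^N)$ for which $$\lim_{\lambda\to0^+}\lambda\,\nu_\gamma(E_{\lambda,\gamma}[u])=\frac{\kappa(1,N)}{|\gamma|}\|\nabla u\|_{\mathcal M}$$ fails in the same sense. (ii) Let $\Omega\subset\mathbb R^N$ be a bounded domain (nonempty, open and connected) with $C^\infty$ boundary and let $u=\mathbf 1_\Omega$. Then $u\in\dot{BV}(\mathbb R^N)$, $$\lim_{\lambda\to\infty}\lambda\,\nu_\gamma(E_{\lambda,\gamma}[u])=\frac{\kappa(1,N)}{|\gamma+1|}\|\nabla u\|_{\mathcal M}\quad\text{for all }\gamma>-1,$$ $$\lim_{\lambda\to0^+}\lambda\,\nu_\gamma(E_{\lambda,\gamma}[u])=\frac{\kappa(1,N)}{|\gamma+1|}\|\nabla u\|_{\mathcal M}\quad\text{for all }\gamma<-1.$$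 Moreover, for $\gamma\in\mathbb R\setminus\{-1,0\}$, one has $\frac{\kappa(1,N)}{|\gamma+1|}\|\nabla u\|_{\mathcal M}=\frac{\kappa(1,N)}{|\gamma|}\|\nabla u\|_{\mathcal M}$ if and only if $\gamma=-\frac12$. In particular, the limits as $\lambda\to\infty$ for $\gamma>0$ and as $\lambda\to0^+$ for $\gamma<-1$ exist but differ from $\frac{\kappa(1,N)}{|\gamma|}\|\nabla u\|_{\mathcal M}$. -/

import Mathlib

open Set Filter Topology MeasureTheory
open scoped ENNReal

noncomputable section

/-- The measure `ν_γ` on `ℝ^N × ℝ^N` with density `|x - y|^(γ - N)` off the diagonal. -/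
def nuMeasure (N : ℕ) (γ : ℝ) :
    Measure (EuclideanSpace ℝ (Fin N) × EuclideanSpace ℝ (Fin N)) :=
  (volume.restrict {z | z.1 ≠ z.2}).withDensity
    fun z => ENNReal.ofReal (‖z.1 - z.2‖ ^ (γ - (N : ℝ)))

/-- The difference quotient `Q_b u (x, y) = (u x - u y) / |x - y|^(1 + b)`. -/
def diffQuot {N : ℕ} (b : ℝ) (u : EuclideanSpace ℝ (Fin N) → ℝ)
    (x y : EuclideanSpace ℝ (Fin N)) : ℝ :=
  (u x - u y) / ‖x - y‖ ^ (1 + b)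

/-- The superlevel set `E_{t,b}[u] = {(x, y) : x ≠ y, |Q_b u (x, y)| > t}`. -/
def superlevelSet {N : ℕ} (t b : ℝ) (u : EuclideanSpace ℝ (Fin N) → ℝ) :
    Set (EuclideanSpace ℝ (Fin N) × EuclideanSpace ℝ (Fin N)) :=
  {z | z.1 ≠ z.2 ∧ t < |diffQuot b u z.1 z.2|}

/-- The constant `κ(p, N) = ∫_{S^{N-1}} |e · θ|^p dθ` (surface measure), where `e` is a unit
vector of `ℝ^N`; the value is the same for every unit vector `e`. -/
def kappa {N : ℕ} (p : ℝ) (e : EuclideanSpace ℝ (Fin N)) : ℝ :=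
  ∫ θ : Metric.sphere (0 : EuclideanSpace ℝ (Fin N)) 1,
    |inner ℝ e (θ : EuclideanSpace ℝ (Fin N))| ^ p
      ∂((volume : Measure (EuclideanSpace ℝ (Fin N))).toSphere)

/-- The divergence of a vector field on `ℝ^N`. -/
def divergence {N : ℕ} (φ : EuclideanSpace ℝ (Fin N) → EuclideanSpace ℝ (Fin N))
    (x : EuclideanSpace ℝ (Fin N)) : ℝ :=
  ∑ i, (fderiv ℝ φ x (EuclideanSpace.single i 1)) i

/-- The total variation `‖∇u‖_ℳ ∈ [0, ∞]` of the distributional gradient of `u`: the supremum of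
`|∫ u div φ|` over `C¹` compactly supported vector fields `φ` with `|φ| ≤ 1` everywhere. -/
def gradVariation {N : ℕ} (u : EuclideanSpace ℝ (Fin N) → ℝ) : ℝ≥0∞ :=
  ⨆ (φ : EuclideanSpace ℝ (Fin N) → EuclideanSpace ℝ (Fin N))
    (_ : ContDiff ℝ 1 φ ∧ HasCompactSupport φ ∧ ∀ x, ‖φ x‖ ≤ 1),
    ENNReal.ofReal |∫ x, u x * divergence φ x|

/-- The homogeneous space of functions of bounded variation on `ℝ^N`. -/
def MemBVDot {N : ℕ} (u : EuclideanSpace ℝ (Fin N) → ℝ) : Prop :=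
  LocallyIntegrable u ∧ gradVariation u < ⊤

/-- `Ω` has smooth boundary: near each boundary point it is the strict sublevel set `{ρ < 0}` of
a `C^∞` function `ρ` whose differential at that point is nonzero. -/
def HasSmoothBoundary {N : ℕ} (Ω : Set (EuclideanSpace ℝ (Fin N))) : Prop :=
  ∀ p ∈ frontier Ω, ∃ (U : Set (EuclideanSpace ℝ (Fin N))) (ρ : EuclideanSpace ℝ (Fin N) → ℝ),
    IsOpen U ∧ p ∈ U ∧ ContDiffOn ℝ ((⊤ : ℕ∞) : WithTop ℕ∞) ρ U ∧ fderiv ℝ ρ p ≠ 0 ∧ Ω ∩ U = {x ∈ U | ρ x < 0}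

/-- A bounded domain (nonempty connected open set) with smooth boundary. -/
structure IsBoundedSmoothDomain {N : ℕ} (Ω : Set (EuclideanSpace ℝ (Fin N))) : Prop where
  isOpen : IsOpen Ω
  isConnected : IsConnected Ω
  isBounded : Bornology.IsBounded Ω
  smoothBoundary : HasSmoothBoundary Ω

end

/-! For `u = 1_Ω` the difference `|u x - u y|` is 0 or 1, so the superlevel set consists of the
pairs separated by `Ω` whose displacement `h` satisfies `t ‖h‖^(1+γ) < 1`. Hence `ν_γ` of it is the
integral of `‖h‖^(γ-N) ∫ |u(x+h) - u(x)| dx` over these `h` (`nuMeasure_superlevelSet`). With `t =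
r^(-(1+γ))` and `h = r k`, the quantity `t ν_γ` becomes an average of `L¹` difference quotients of
`u` at scale `r`, against a weight independent of `r` (`mul_nuMeasure_superlevelSet`). The relevant
limits of `t` are exactly `r → 0⁺`, where such averages converge to `K ‖∇u‖` for any isotropic
weight (`tendsto_translationEnergy`). Polar coordinates give `K = κ/|γ+1|`, the radial factor being
the integral of `s^γ` over `(0,1)` or `(1,∞)`.

The convergence of averages is proved in `[0,∞]`, without assuming bounded variation: for smooth
functions by the mean value formula and Fatou, and in general by mollification, which increases
neither the averages nor the variation. Finiteness of the variation of `1_Ω` then follows from the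
linear bound on translates in `exists_translationDefect_bound`.

The failures in (i) are all seen on the unit ball. For `γ > 0` and `γ < -1` the limit has the factor
`1/|γ+1|` instead of `1/|γ|`. For `-1 < γ < 0` the measures stay bounded, so the limit at `0⁺` is 0.
For `γ = -1` they do not depend on small `t`, so the limit is 0 or `∞`. -/

noncomputable section

set_option linter.unusedSectionVars false

/-! ### Averaged difference quotients of `C¹` functions. -/

section TranslationEnergy

variable {E : Type*} [NormedAddCommGroup E] [InnerProductSpace ℝ E] [FiniteDimensional ℝ E]
  [MeasurableSpace E] [BorelSpace E]

/-- The `L¹` modulus `∫ |u (x + h) - u x| dx` of a translation. -/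
def translationDefect (u : E → ℝ) (h : E) : ℝ≥0∞ := ∫⁻ x, ‖u (x + h) - u x‖ₑ

/-- The `L¹` translation modulus at scale `r`, averaged against the weight `w`. -/
def translationEnergy (w : E → ℝ≥0∞) (u : E → ℝ) (r : ℝ) : ℝ≥0∞ :=
  ∫⁻ k, w k * (translationDefect u (r • k) / ENNReal.ofReal r)

theorem measurable_translationDefect {u : E → ℝ} (hu : Measurable u) :
    Measurable (translationDefect u) := by
  unfold translationDefect
  have : Measurable fun p : E × E => ‖u (p.2 + p.1) - u p.2‖ₑ := by fun_prop
  exact this.lintegral_prod_right'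

theorem enorm_sub_le_lintegral_fderiv {v : E → ℝ} (hv : ContDiff ℝ 1 v) (x h : E) :
    ‖v (x + h) - v x‖ₑ ≤ ∫⁻ τ in Icc (0 : ℝ) 1, ‖fderiv ℝ v (x + τ • h) h‖ₑ := by
  have hd : ∀ τ : ℝ, HasDerivAt (fun τ : ℝ => v (x + τ • h)) (fderiv ℝ v (x + τ • h) h) τ := by
    intro τ
    have h1 : HasDerivAt (fun τ : ℝ => x + τ • h) h τ := by
      simpa using ((hasDerivAt_id τ).smul_const h).const_add x
    exact ((hv.differentiable one_ne_zero).differentiableAt.hasFDerivAt).comp_hasDerivAt τ h1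
  have hc : Continuous fun τ : ℝ => fderiv ℝ v (x + τ • h) h :=
    ((hv.continuous_fderiv one_ne_zero).comp (by fun_prop)).clm_apply continuous_const
  have hi := intervalIntegral.integral_eq_sub_of_hasDerivAt (a := 0) (b := 1)
    (fun τ _ => hd τ) (hc.intervalIntegrable 0 1)
  simp only [one_smul, zero_smul, add_zero] at hi
  rw [← hi, intervalIntegral.integral_of_le zero_le_one, ← integral_Icc_eq_integral_Ioc]
  exact enorm_integral_le_lintegral_enorm _

/-- Integrate the mean value formula over `x`: after Tonelli, each slice `τ` contributes the same
amount by translation invariance. -/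
theorem translationDefect_le_lintegral_fderiv {v : E → ℝ} (hv : ContDiff ℝ 1 v) (h : E) :
    translationDefect v h ≤ ∫⁻ x, ‖fderiv ℝ v x h‖ₑ := by
  have hc : Continuous (fderiv ℝ v) := hv.continuous_fderiv one_ne_zero
  calc translationDefect v h
      ≤ ∫⁻ x, ∫⁻ τ in Icc (0 : ℝ) 1, ‖fderiv ℝ v (x + τ • h) h‖ₑ :=
        lintegral_mono fun x => enorm_sub_le_lintegral_fderiv hv x h
    _ = ∫⁻ τ in Icc (0 : ℝ) 1, ∫⁻ x, ‖fderiv ℝ v (x + τ • h) h‖ₑ := by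
        apply lintegral_lintegral_swap
        apply Continuous.aemeasurable
        have : Continuous fun p : E × ℝ => fderiv ℝ v (p.1 + p.2 • h) h :=
          (hc.comp (by fun_prop)).clm_apply continuous_const
        exact this.enorm
    _ = ∫⁻ τ in Icc (0 : ℝ) 1, ∫⁻ x, ‖fderiv ℝ v x h‖ₑ := by
        congr 1 with τ
        exact lintegral_add_right_eq_self (fun x => ‖fderiv ℝ v x h‖ₑ) (τ • h)
    _ = ∫⁻ x, ‖fderiv ℝ v x h‖ₑ := by simp

/-- The weight `w` integrates `|L k|` to `K ‖L‖` for every linear form `L`. -/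
def IsIsotropicWeight (w : E → ℝ≥0∞) (K : ℝ≥0∞) : Prop :=
  Measurable w ∧ ∀ L : E →L[ℝ] ℝ, ∫⁻ k, w k * ‖L k‖ₑ = K * ‖L‖ₑ

/-- Isotropy is applied pointwise in `x` to the linear form `fderiv ℝ v x`, after Tonelli. This is
where directional derivatives turn into the full gradient norm. -/
theorem lintegral_weight_fderiv {w : E → ℝ≥0∞} {K : ℝ≥0∞} (hw : IsIsotropicWeight w K)
    {v : E → ℝ} (hv : ContDiff ℝ 1 v) :
    ∫⁻ k, w k * ∫⁻ x, ‖fderiv ℝ v x k‖ₑ = K * ∫⁻ x, ‖fderiv ℝ v x‖ₑ := by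
  have hc : Continuous (fderiv ℝ v) := hv.continuous_fderiv one_ne_zero
  have hc2 : Continuous fun p : E × E => fderiv ℝ v p.2 p.1 :=
    (hc.comp continuous_snd).clm_apply continuous_fst
  calc ∫⁻ k, w k * ∫⁻ x, ‖fderiv ℝ v x k‖ₑ
      = ∫⁻ k, ∫⁻ x, w k * ‖fderiv ℝ v x k‖ₑ := by
        congr 1 with k
        rw [lintegral_const_mul]
        exact (hc.clm_apply continuous_const).enorm.measurable
    _ = ∫⁻ x, ∫⁻ k, w k * ‖fderiv ℝ v x k‖ₑ := by
        apply lintegral_lintegral_swap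
        exact ((hw.1.comp measurable_fst).mul hc2.enorm.measurable).aemeasurable
    _ = ∫⁻ x, K * ‖fderiv ℝ v x‖ₑ := by simp_rw [hw.2]
    _ = _ := lintegral_const_mul _ hc.enorm.measurable

theorem translationEnergy_le_of_contDiff {w : E → ℝ≥0∞} {K : ℝ≥0∞} (hw : IsIsotropicWeight w K)
    {v : E → ℝ} (hv : ContDiff ℝ 1 v) {r : ℝ} (hr : 0 < r) :
    translationEnergy w v r ≤ K * ∫⁻ x, ‖fderiv ℝ v x‖ₑ := by
  rw [← lintegral_weight_fderiv hw hv]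
  refine lintegral_mono fun k => ?_
  dsimp only
  gcongr
  refine ENNReal.div_le_of_le_mul ?_
  refine (translationDefect_le_lintegral_fderiv hv _).trans ?_
  rw [mul_comm, ← lintegral_const_mul' _ _ ENNReal.ofReal_ne_top]
  refine lintegral_mono fun x => ?_
  rw [map_smul, smul_eq_mul, enorm_mul, Real.enorm_of_nonneg hr.le]

theorem tendsto_translation_div {v : E → ℝ} (hv : ContDiff ℝ 1 v) (x k : E) :
    Tendsto (fun r : ℝ => ‖v (x + r • k) - v x‖ₑ / ENNReal.ofReal r) (𝓝[>] 0)
      (𝓝 ‖fderiv ℝ v x k‖ₑ) := by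
  have h1 : HasDerivAt (fun r : ℝ => v (x + r • k)) (fderiv ℝ v x k) 0 := by
    have h1 : HasDerivAt (fun τ : ℝ => x + τ • k) k 0 := by
      simpa using ((hasDerivAt_id (0 : ℝ)).smul_const k).const_add x
    have h2 : HasFDerivAt v (fderiv ℝ v x) (x + (0 : ℝ) • k) := by
      simpa using ((hv.differentiable one_ne_zero) x).hasFDerivAt
    exact h2.comp_hasDerivAt 0 h1
  have h2 := (h1.tendsto_slope_zero_right).enorm
  refine h2.congr' ?_
  filter_upwards [self_mem_nhdsWithin] with r hr
  have hr : 0 < r := hr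
  simp only [zero_add, zero_smul, add_zero, smul_eq_mul]
  rw [enorm_mul, enorm_inv hr.ne', Real.enorm_of_nonneg hr.le, mul_comm, ENNReal.div_eq_inv_mul,
    mul_comm]

/-- Fatou twice, in `x` for each direction `k` and then in `k`; no integrability of the gradient is
needed. -/
theorem le_liminf_translationEnergy_of_contDiff {w : E → ℝ≥0∞} {K : ℝ≥0∞}
    (hw : IsIsotropicWeight w K) {v : E → ℝ} (hv : ContDiff ℝ 1 v) :
    K * ∫⁻ x, ‖fderiv ℝ v x‖ₑ ≤ liminf (translationEnergy w v) (𝓝[>] 0) := by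
  rw [← lintegral_weight_fderiv hw hv]
  have hvm : Measurable v := hv.continuous.measurable
  have hF : ∀ k, ∫⁻ x, ‖fderiv ℝ v x k‖ₑ ≤
      liminf (fun r : ℝ => translationDefect v (r • k) / ENNReal.ofReal r) (𝓝[>] 0) := by
    intro k
    calc ∫⁻ x, ‖fderiv ℝ v x k‖ₑ
        = ∫⁻ x, liminf (fun r : ℝ => ‖v (x + r • k) - v x‖ₑ / ENNReal.ofReal r) (𝓝[>] 0) := by
          congr 1 with x
          exact (tendsto_translation_div hv x k).liminf_eq.symm
      _ ≤ liminf (fun r : ℝ => ∫⁻ x, ‖v (x + r • k) - v x‖ₑ / ENNReal.ofReal r) (𝓝[>] 0) := by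
          apply lintegral_liminf_le
          intro r
          fun_prop
      _ = _ := by
          congr 1 with r
          simp_rw [div_eq_mul_inv]
          rw [lintegral_mul_const]
          · rfl
          · fun_prop
  calc ∫⁻ k, w k * ∫⁻ x, ‖fderiv ℝ v x k‖ₑ
      ≤ ∫⁻ k, liminf (fun r : ℝ => w k * (translationDefect v (r • k) / ENNReal.ofReal r))
          (𝓝[>] 0) := by
        refine lintegral_mono fun k => ?_
        refine (mul_le_mul_right (hF k) (w k)).trans ?_
        exact ENNReal.le_liminf_mul.trans' (by simp)
    _ ≤ _ := by
        apply lintegral_liminf_le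
        intro r
        have := measurable_translationDefect hvm
        have := hw.1
        fun_prop

end TranslationEnergy

/-! ### Total variation of smooth functions as the integral of the gradient norm. -/

section SmoothVariation

variable {N : ℕ}

theorem divergence_eq_sum_fderiv {φ : EuclideanSpace ℝ (Fin N) → EuclideanSpace ℝ (Fin N)}
    (hφ : ContDiff ℝ 1 φ) (x : EuclideanSpace ℝ (Fin N)) :
    divergence φ x =
      ∑ i, fderiv ℝ (fun y => φ y i) x (EuclideanSpace.single i (1 : ℝ)) := by
  refine Finset.sum_congr rfl fun i _ => ?_
  have h := ((EuclideanSpace.proj i : EuclideanSpace ℝ (Fin N) →L[ℝ] ℝ).hasFDerivAt).comp x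
    ((hφ.differentiable one_ne_zero) x).hasFDerivAt
  have h' : HasFDerivAt (fun y => φ y i)
    ((EuclideanSpace.proj i : EuclideanSpace ℝ (Fin N) →L[ℝ] ℝ).comp (fderiv ℝ φ x)) x := h
  rw [h'.fderiv]
  rfl

theorem continuous_divergence {φ : EuclideanSpace ℝ (Fin N) → EuclideanSpace ℝ (Fin N)}
    (hφ : ContDiff ℝ 1 φ) : Continuous (divergence φ) := by
  have hc : Continuous (fderiv ℝ φ) := hφ.continuous_fderiv one_ne_zero
  unfold divergence
  refine continuous_finsetSum _ fun i _ => ?_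
  exact (EuclideanSpace.proj i : EuclideanSpace ℝ (Fin N) →L[ℝ] ℝ).continuous.comp
    (hc.clm_apply continuous_const)

theorem hasCompactSupport_divergence
    {φ : EuclideanSpace ℝ (Fin N) → EuclideanSpace ℝ (Fin N)} (hφ : HasCompactSupport φ) :
    HasCompactSupport (divergence φ) := by
  refine (hφ.fderiv (𝕜 := ℝ)).mono fun x hx => ?_
  contrapose! hx
  simp only [Function.mem_support, not_not] at hx ⊢
  simp [divergence, hx]

theorem integral_mul_divergence {v : EuclideanSpace ℝ (Fin N) → ℝ} (hv : ContDiff ℝ 1 v)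
    {φ : EuclideanSpace ℝ (Fin N) → EuclideanSpace ℝ (Fin N)} (hφ : ContDiff ℝ 1 φ)
    (hφc : HasCompactSupport φ) :
    ∫ x, v x * divergence φ x = - ∫ x, fderiv ℝ v x (φ x) := by
  have hvc : Continuous (fderiv ℝ v) := hv.continuous_fderiv one_ne_zero
  have hcoord : ∀ i, ContDiff ℝ 1 fun y => φ y i := fun i =>
    (EuclideanSpace.proj i : EuclideanSpace ℝ (Fin N) →L[ℝ] ℝ).contDiff.comp hφ
  have hcomp : ∀ i, HasCompactSupport fun y => φ y i := fun i =>
    hφc.comp_left (g := fun z : EuclideanSpace ℝ (Fin N) => z i) (by simp)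
  have hd : ∀ i, Continuous fun x =>
      fderiv ℝ (fun y => φ y i) x (EuclideanSpace.single i (1 : ℝ)) := fun i =>
    ((hcoord i).continuous_fderiv one_ne_zero).clm_apply continuous_const
  have hI1 : ∀ i, Integrable fun x =>
      v x * fderiv ℝ (fun y => φ y i) x (EuclideanSpace.single i (1 : ℝ)) := fun i =>
    (hv.continuous.mul (hd i)).integrable_of_hasCompactSupport
      (((hcomp i).fderiv_apply (𝕜 := ℝ) _).mul_left)
  have hI2 : ∀ i, Integrable fun x =>
      fderiv ℝ v x (EuclideanSpace.single i (1 : ℝ)) * φ x i := fun i =>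
    ((hvc.clm_apply continuous_const).mul (hcoord i).continuous).integrable_of_hasCompactSupport
      ((hcomp i).mul_left)
  have hI3 : ∀ i, Integrable fun x => v x * φ x i := fun i =>
    (hv.continuous.mul (hcoord i).continuous).integrable_of_hasCompactSupport
      ((hcomp i).mul_left)
  have hexp : ∀ x, fderiv ℝ v x (φ x) =
      ∑ i, fderiv ℝ v x (EuclideanSpace.single i (1 : ℝ)) * φ x i := by
    intro x
    conv_lhs => rw [← (EuclideanSpace.basisFun (Fin N) ℝ).sum_repr (φ x)]
    simp [mul_comm]
  simp_rw [hexp, divergence_eq_sum_fderiv hφ, Finset.mul_sum]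
  rw [integral_finsetSum _ fun i _ => hI1 i, integral_finsetSum _ fun i _ => hI2 i,
    ← Finset.sum_neg_distrib]
  refine Finset.sum_congr rfl fun i _ => ?_
  exact integral_mul_fderiv_eq_neg_fderiv_mul_of_integrable (hI2 i) (hI1 i) (hI3 i)
    (fun x _ => hv.differentiable one_ne_zero x)
    (fun x _ => (hcoord i).differentiable one_ne_zero x)

theorem gradVariation_le_lintegral_fderiv {v : EuclideanSpace ℝ (Fin N) → ℝ}
    (hv : ContDiff ℝ 1 v) : gradVariation v ≤ ∫⁻ x, ‖fderiv ℝ v x‖ₑ := by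
  refine iSup₂_le fun φ hφ => ?_
  rw [integral_mul_divergence hv hφ.1 hφ.2.1, abs_neg, ← Real.norm_eq_abs, ofReal_norm]
  refine (enorm_integral_le_lintegral_enorm _).trans (lintegral_mono fun x => ?_)
  rw [← ofReal_norm, ← ofReal_norm]
  refine ENNReal.ofReal_le_ofReal ((ContinuousLinearMap.le_opNorm _ _).trans ?_)
  exact mul_le_of_le_one_right (norm_nonneg _) (hφ.2.2 x)

theorem enorm_integral_mul_divergence_le (u : EuclideanSpace ℝ (Fin N) → ℝ)
    {φ : EuclideanSpace ℝ (Fin N) → EuclideanSpace ℝ (Fin N)}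
    (h1 : ContDiff ℝ 1 φ) (h2 : HasCompactSupport φ) (h3 : ∀ x, ‖φ x‖ ≤ 1) :
    ‖∫ x, u x * divergence φ x‖ₑ ≤ gradVariation u := by
  rw [← ofReal_norm, Real.norm_eq_abs]
  exact le_iSup₂ (f := fun φ _ => ENNReal.ofReal |∫ x, u x * divergence φ x|) φ ⟨h1, h2, h3⟩

/-- A smooth, compactly supported approximation of the unit vector field `-∇v / |∇v|`. -/
def regularizedDirection (v : EuclideanSpace ℝ (Fin N) → ℝ) (η : ℝ)
    (x : EuclideanSpace ℝ (Fin N)) : EuclideanSpace ℝ (Fin N) :=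
  -(√(‖gradient v x‖ ^ 2 + η ^ 2))⁻¹ • gradient v x

theorem norm_gradient_eq (v : EuclideanSpace ℝ (Fin N) → ℝ) (x : EuclideanSpace ℝ (Fin N)) :
    ‖gradient v x‖ = ‖fderiv ℝ v x‖ := by
  simp [gradient]

theorem contDiff_regularizedDirection {v : EuclideanSpace ℝ (Fin N) → ℝ} (hv : ContDiff ℝ 2 v)
    {η : ℝ} (hη : 0 < η) : ContDiff ℝ 1 (regularizedDirection v η) := by
  have hg : ContDiff ℝ 1 (gradient v) :=
    (InnerProductSpace.toDual ℝ (EuclideanSpace ℝ (Fin N))).symm.contDiff.comp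
      (hv.fderiv_right (m := 1) (by norm_num))
  unfold regularizedDirection
  have hpos : ∀ x, ‖gradient v x‖ ^ 2 + η ^ 2 ≠ 0 := fun x => by positivity
  have hs : ContDiff ℝ 1 fun x => √(‖gradient v x‖ ^ 2 + η ^ 2) :=
    ((hg.norm_sq ℝ).add contDiff_const).sqrt hpos
  exact ((hs.inv fun x => (Real.sqrt_pos.2 (by positivity)).ne').neg).smul hg

theorem hasCompactSupport_regularizedDirection {v : EuclideanSpace ℝ (Fin N) → ℝ}
    (hv : HasCompactSupport v) (η : ℝ) : HasCompactSupport (regularizedDirection v η) := by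
  refine (hv.fderiv (𝕜 := ℝ)).mono fun x hx => ?_
  contrapose! hx
  simp only [Function.mem_support, not_not] at hx ⊢
  simp [regularizedDirection, gradient, hx]

theorem norm_regularizedDirection_le (v : EuclideanSpace ℝ (Fin N) → ℝ) (η : ℝ)
    (x : EuclideanSpace ℝ (Fin N)) : ‖regularizedDirection v η x‖ ≤ 1 := by
  rw [regularizedDirection, norm_smul, norm_neg, norm_inv, Real.norm_of_nonneg (Real.sqrt_nonneg _),
    inv_mul_eq_div]
  refine div_le_one_of_le₀ (Real.le_sqrt_of_sq_le ?_) (Real.sqrt_nonneg _)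
  nlinarith [sq_nonneg η]

theorem fderiv_regularizedDirection (v : EuclideanSpace ℝ (Fin N) → ℝ) (η : ℝ)
    (x : EuclideanSpace ℝ (Fin N)) : -fderiv ℝ v x (regularizedDirection v η x) =
      ‖fderiv ℝ v x‖ ^ 2 / √(‖fderiv ℝ v x‖ ^ 2 + η ^ 2) := by
  have h : fderiv ℝ v x (gradient v x) = ‖fderiv ℝ v x‖ ^ 2 := by
    rw [← norm_gradient_eq, ← real_inner_self_eq_norm_sq]
    conv_rhs => rw [gradient, InnerProductSpace.toDual_symm_apply]
    rfl
  rw [regularizedDirection, map_smul, h, norm_gradient_eq, smul_eq_mul]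
  ring

theorem tendsto_sq_div_sqrt_sq_add_sq (a : ℝ) (ha : 0 ≤ a) :
    Tendsto (fun η : ℝ => a ^ 2 / √(a ^ 2 + η ^ 2)) (𝓝[>] 0) (𝓝 a) := by
  rcases ha.eq_or_lt with rfl | ha
  · simp
  have h : ContinuousAt (fun η : ℝ => a ^ 2 / √(a ^ 2 + η ^ 2)) 0 := by
    refine ContinuousAt.div (by fun_prop) (by fun_prop) ?_
    simp only [ne_eq, OfNat.ofNat_ne_zero, not_false_eq_true, zero_pow, add_zero]
    exact (Real.sqrt_pos.2 (by positivity)).ne'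
  have h2 := h.tendsto
  have e : a ^ 2 / √(a ^ 2 + 0 ^ 2) = a := by
    rw [zero_pow two_ne_zero, add_zero, Real.sqrt_sq ha.le]
    field_simp
  rw [e] at h2
  exact h2.mono_left nhdsWithin_le_nhds

/-- Test the supremum with `regularizedDirection v η` and let `η → 0⁺` by Fatou. The parameter `η`
keeps the field smooth at critical points of `v`; `C²` is required so that the field is `C¹`. -/
theorem lintegral_fderiv_le_gradVariation {v : EuclideanSpace ℝ (Fin N) → ℝ}
    (hv : ContDiff ℝ 2 v) (hvc : HasCompactSupport v) :
    ∫⁻ x, ‖fderiv ℝ v x‖ₑ ≤ gradVariation v := by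
  have hc : Continuous (fderiv ℝ v) := hv.continuous_fderiv two_ne_zero
  have hv1 : ContDiff ℝ 1 v := hv.of_le one_le_two
  let F : ℝ → EuclideanSpace ℝ (Fin N) → ℝ := fun η x =>
    ‖fderiv ℝ v x‖ ^ 2 / √(‖fderiv ℝ v x‖ ^ 2 + η ^ 2)
  have hF0 : ∀ η x, 0 ≤ F η x := fun η x => by positivity
  have hFm : ∀ η, Measurable fun x => ENNReal.ofReal (F η x) := fun η => by
    have := hc.measurable
    fun_prop
  calc ∫⁻ x, ‖fderiv ℝ v x‖ₑ
      = ∫⁻ x, liminf (fun η => ENNReal.ofReal (F η x)) (𝓝[>] 0) := by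
        congr 1 with x
        rw [← ofReal_norm]
        exact (ENNReal.tendsto_ofReal
          (tendsto_sq_div_sqrt_sq_add_sq _ (norm_nonneg _))).liminf_eq.symm
    _ ≤ liminf (fun η => ∫⁻ x, ENNReal.ofReal (F η x)) (𝓝[>] 0) := lintegral_liminf_le hFm
    _ ≤ gradVariation v := by
        refine (liminf_le_liminf (v := fun _ => gradVariation v) ?_).trans_eq (liminf_const _)
        filter_upwards [self_mem_nhdsWithin] with η hη
        have h1 := contDiff_regularizedDirection hv hη
        have h2 := hasCompactSupport_regularizedDirection hvc η
        have h := enorm_integral_mul_divergence_le v h1 h2 (norm_regularizedDirection_le v η)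
        rw [integral_mul_divergence hv1 h1 h2, ← integral_neg] at h
        have hi : Integrable fun x => -fderiv ℝ v x (regularizedDirection v η x) := by
          refine Continuous.integrable_of_hasCompactSupport
            (hc.clm_apply h1.continuous).neg (h2.mono fun x hx => ?_)
          contrapose! hx
          simp only [Function.mem_support, not_not] at hx ⊢
          simp [hx]
        simp_rw [fderiv_regularizedDirection] at h hi
        rw [← ofReal_integral_eq_lintegral_ofReal hi (Eventually.of_forall (hF0 η))]
        rwa [← ofReal_norm, Real.norm_of_nonneg (integral_nonneg (hF0 η))] at h

end SmoothVariation

/-! ### Mollification decreases translation moduli and variation. -/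

section Mollification

variable {E : Type*} [NormedAddCommGroup E] [InnerProductSpace ℝ E] [FiniteDimensional ℝ E]
  [MeasurableSpace E] [BorelSpace E]

/-- The convolution of `u` with the kernel `ρ`. -/
def mollify (ρ u : E → ℝ) (x : E) : ℝ := ∫ y, ρ y * u (x - y)

/-- A `C²` compactly supported probability density. -/
structure IsMollifier (ρ : E → ℝ) : Prop where
  contDiff : ContDiff ℝ 2 ρ
  hasCompactSupport : HasCompactSupport ρ
  nonneg : ∀ x, 0 ≤ ρ x
  integral_eq_one : ∫ x, ρ x = 1

theorem IsMollifier.integrable {ρ : E → ℝ} (hρ : IsMollifier ρ) : Integrable ρ :=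
  hρ.contDiff.continuous.integrable_of_hasCompactSupport hρ.hasCompactSupport

theorem IsMollifier.lintegral_enorm {ρ : E → ℝ} (hρ : IsMollifier ρ) : ∫⁻ x, ‖ρ x‖ₑ = 1 := by
  rw [← ofReal_integral_norm_eq_lintegral_enorm hρ.integrable]
  simp_rw [Real.norm_of_nonneg (hρ.nonneg _), hρ.integral_eq_one]
  simp

theorem contDiff_mollify {ρ u : E → ℝ} (hρ : IsMollifier ρ) (hu : Integrable u) :
    ContDiff ℝ 2 (mollify ρ u) :=
  HasCompactSupport.contDiff_convolution_left (n := 2) (ContinuousLinearMap.lsmul ℝ ℝ)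
    hρ.hasCompactSupport hρ.contDiff hu.locallyIntegrable

theorem hasCompactSupport_mollify {ρ u : E → ℝ} (hρ : IsMollifier ρ) (hu : HasCompactSupport u) :
    HasCompactSupport (mollify ρ u) :=
  HasCompactSupport.convolution (ContinuousLinearMap.lsmul ℝ ℝ) hρ.hasCompactSupport hu

theorem integrable_mollify_integrand {ρ u : E → ℝ} (hρ : IsMollifier ρ) (hu : Integrable u)
    (x : E) : Integrable fun y => ρ y * u (x - y) :=
  hρ.hasCompactSupport.convolutionExists_left (ContinuousLinearMap.lsmul ℝ ℝ)
    hρ.contDiff.continuous hu.locallyIntegrable x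

theorem abs_mollify_le_one {ρ u : E → ℝ} (hρ : IsMollifier ρ) (hu1 : ∀ x, |u x| ≤ 1) (x : E) :
    |mollify ρ u x| ≤ 1 := by
  rw [← hρ.integral_eq_one, mollify, ← Real.norm_eq_abs]
  refine norm_integral_le_of_norm_le hρ.integrable (Eventually.of_forall fun y => ?_)
  rw [norm_mul, Real.norm_of_nonneg (hρ.nonneg y)]
  exact mul_le_of_le_one_right (hρ.nonneg y) (hu1 _)

/-- A mollification is an average of translates of `u`, all of which have the same modulus. -/
theorem translationDefect_mollify_le {ρ u : E → ℝ} (hρ : IsMollifier ρ) (hu : Integrable u)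
    (hum : Measurable u) (h : E) :
    translationDefect (mollify ρ u) h ≤ translationDefect u h := by
  have hρm : Measurable ρ := hρ.contDiff.continuous.measurable
  calc translationDefect (mollify ρ u) h
      ≤ ∫⁻ x, ∫⁻ y, ‖ρ y‖ₑ * ‖u (x - y + h) - u (x - y)‖ₑ := by
        refine lintegral_mono fun x => ?_
        rw [mollify, mollify, ← integral_sub (integrable_mollify_integrand hρ hu _)
          (integrable_mollify_integrand hρ hu _)]
        refine (enorm_integral_le_lintegral_enorm _).trans_eq ?_
        congr 1 with y
        rw [← mul_sub, enorm_mul, add_sub_right_comm]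
    _ = ∫⁻ y, ∫⁻ x, ‖ρ y‖ₑ * ‖u (x - y + h) - u (x - y)‖ₑ := by
        apply lintegral_lintegral_swap
        apply Measurable.aemeasurable
        unfold Function.uncurry
        fun_prop
    _ = ∫⁻ y, ‖ρ y‖ₑ * translationDefect u h := by
        congr 1 with y
        rw [lintegral_const_mul _ (by fun_prop),
          lintegral_sub_right_eq_self (fun x => ‖u (x + h) - u x‖ₑ) y]
        rfl
    _ = translationDefect u h := by
        rw [lintegral_mul_const _ (by fun_prop), hρ.lintegral_enorm, one_mul]

theorem translationEnergy_mollify_le (w : E → ℝ≥0∞) {ρ u : E → ℝ} (hρ : IsMollifier ρ)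
    (hu : Integrable u) (hum : Measurable u) (r : ℝ) :
    translationEnergy w (mollify ρ u) r ≤ translationEnergy w u r := by
  unfold translationEnergy
  gcongr with k
  exact translationDefect_mollify_le hρ hu hum _

theorem gradVariation_mollify_le {N : ℕ} {ρ u : EuclideanSpace ℝ (Fin N) → ℝ}
    (hρ : IsMollifier ρ) (hu : Integrable u) :
    gradVariation (mollify ρ u) ≤ gradVariation u := by
  refine iSup₂_le fun φ hφ => ?_
  have hψ := continuous_divergence hφ.1
  have hψc := hasCompactSupport_divergence hφ.2.1
  obtain ⟨C, hC⟩ := hψ.bounded_above_of_compact_support hψc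
  have hint : Integrable (fun p : EuclideanSpace ℝ (Fin N) × EuclideanSpace ℝ (Fin N) =>
      ρ p.2 * u (p.1 - p.2) * divergence φ p.1) (volume.prod volume) :=
    (hρ.integrable.convolution_integrand (ContinuousLinearMap.lsmul ℝ ℝ) hu).mul_bdd (c := C)
      (hψ.comp continuous_fst).aestronglyMeasurable (Eventually.of_forall fun p => hC p.1)
  -- Moving the translation from `u` onto `φ` yields another admissible field.
  have hkey : ∀ y, ‖∫ x, u (x - y) * divergence φ x‖ₑ ≤ gradVariation u := by
    intro y
    have hs := integral_sub_right_eq_self (μ := volume) (fun x => u x * divergence φ (x + y)) y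
    simp only [sub_add_cancel] at hs
    have hdiv : ∀ x, divergence φ (x + y) = divergence (fun z => φ (z + y)) x := by
      intro x
      simp [divergence, fderiv_comp_add_right]
    rw [hs]
    simp_rw [hdiv]
    refine enorm_integral_mul_divergence_le u (hφ.1.comp (contDiff_id.add contDiff_const)) ?_
      fun x => hφ.2.2 _
    exact hφ.2.1.comp_homeomorph (Homeomorph.addRight y)
  have hswap : ∫ x, mollify ρ u x * divergence φ x =
      ∫ y, ρ y * ∫ x, u (x - y) * divergence φ x := by
    simp_rw [mollify, ← integral_mul_const, ← integral_const_mul]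
    rw [integral_integral_swap hint]
    simp_rw [mul_assoc]
  rw [hswap, ← Real.norm_eq_abs, ofReal_norm]
  calc _ ≤ ∫⁻ y, ‖ρ y * ∫ x, u (x - y) * divergence φ x‖ₑ := enorm_integral_le_lintegral_enorm _
    _ ≤ ∫⁻ y, ‖ρ y‖ₑ * gradVariation u := by
        refine lintegral_mono fun y => ?_
        rw [enorm_mul]
        gcongr
        exact hkey y
    _ = gradVariation u := by
        rw [lintegral_mul_const _ hρ.contDiff.continuous.measurable.enorm, hρ.lintegral_enorm,
          one_mul]

theorem exists_mollifier_seq {u : E → ℝ} (hu : LocallyIntegrable u) :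
    ∃ ρ : ℕ → E → ℝ, (∀ n, IsMollifier (ρ n)) ∧
      ∀ᵐ x, Tendsto (fun n => mollify (ρ n) u x) atTop (𝓝 (u x)) := by
  -- The constant ratio 2 of the outer to the inner radius is what the Lebesgue differentiation
  -- argument requires.
  let b : ℕ → ContDiffBump (0 : E) := fun n =>
    { rIn := 1 / ((n : ℝ) + 1)
      rOut := 2 * (1 / ((n : ℝ) + 1))
      rIn_pos := by positivity
      rIn_lt_rOut := by
        have : 0 < 1 / ((n : ℝ) + 1) := by positivity
        linarith }
  refine ⟨fun n => (b n).normed volume, fun n => ⟨?_, (b n).hasCompactSupport_normed,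
    (b n).nonneg_normed, (b n).integral_normed⟩, ?_⟩
  · exact (b n).contDiff_normed (n := 2)
  · refine ContDiffBump.ae_convolution_tendsto_right_of_locallyIntegrable (K := 2) (φ := b) ?_ ?_ hu
    · have h := (tendsto_one_div_add_atTop_nhds_zero_nat (𝕜 := ℝ)).const_mul 2
      rwa [mul_zero] at h
    · exact Eventually.of_forall fun n => le_rfl

end Mollification

/-! ### Convergence of the averaged difference quotients to the variation. -/

section EnergyBounds

variable {N : ℕ} {u : EuclideanSpace ℝ (Fin N) → ℝ} {w : EuclideanSpace ℝ (Fin N) → ℝ≥0∞}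
  {K : ℝ≥0∞}

theorem integrable_of_abs_le_one (hum : Measurable u) (hu1 : ∀ x, |u x| ≤ 1)
    (huc : HasCompactSupport u) : Integrable u := by
  have h1 : IntegrableOn u (tsupport u) :=
    Measure.integrableOn_of_bounded (M := 1) huc.isCompact.measure_lt_top.ne
      hum.aestronglyMeasurable (Eventually.of_forall fun x => hu1 x)
  exact (integrableOn_iff_integrable_of_support_subset (subset_tsupport u)).1 h1

/-- Fatou along a mollifying sequence reduces to smooth functions, whose variation is at most that
of `u`. The bound holds at every scale `r`, not only in the limit. -/
theorem translationEnergy_le (hw : IsIsotropicWeight w K)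
    (hui : Integrable u) (huc : HasCompactSupport u) {r : ℝ} (hr : 0 < r) :
    translationEnergy w u r ≤ K * gradVariation u := by
  obtain ⟨ρ, hρ, hlim⟩ := exists_mollifier_seq hui.locallyIntegrable
  have hc : ∀ n, Measurable (mollify (ρ n) u) := fun n =>
    (contDiff_mollify (hρ n) hui).continuous.measurable
  have hdefect : ∀ h, translationDefect u h ≤
      liminf (fun n => translationDefect (mollify (ρ n) u) h) atTop := by
    intro h
    calc translationDefect u h
        = ∫⁻ x, liminf (fun n => ‖mollify (ρ n) u (x + h) - mollify (ρ n) u x‖ₑ) atTop := by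
          refine lintegral_congr_ae ?_
          -- Convergence is needed at `x` and at `x + h`; the exceptional null set is translated.
          have hlim' := (measurePreserving_add_right volume h).quasiMeasurePreserving.ae hlim
          filter_upwards [hlim, hlim'] with x h1 h2
          exact ((h2.sub h1).enorm.liminf_eq).symm
      _ ≤ _ := lintegral_liminf_le fun n => by have := hc n; fun_prop
  calc translationEnergy w u r
      ≤ ∫⁻ k, liminf (fun n =>
          w k * (translationDefect (mollify (ρ n) u) (r • k) / ENNReal.ofReal r)) atTop := by
        refine lintegral_mono fun k => ?_
        simp_rw [div_eq_mul_inv]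
        refine le_trans ?_ (ENNReal.le_liminf_mul.trans' (by rw [liminf_const]))
        gcongr
        refine (mul_le_mul_left (hdefect (r • k)) _).trans ?_
        exact ENNReal.le_liminf_mul.trans' (by rw [liminf_const])
    _ ≤ liminf (fun n => translationEnergy w (mollify (ρ n) u) r) atTop := by
        refine lintegral_liminf_le fun n => ?_
        have := measurable_translationDefect (hc n)
        have := hw.1
        fun_prop
    _ ≤ K * gradVariation u := by
        refine (liminf_le_liminf (v := fun _ => K * gradVariation u) ?_).trans_eq (liminf_const _)
        refine Eventually.of_forall fun n => ?_
        have h2 := contDiff_mollify (hρ n) hui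
        refine (translationEnergy_le_of_contDiff hw (h2.of_le one_le_two) hr).trans ?_
        gcongr
        exact (lintegral_fderiv_le_gradVariation h2
          (hasCompactSupport_mollify (hρ n) huc)).trans (gradVariation_mollify_le (hρ n) hui)

/-- For a fixed mollification the smooth lower bound applies, and its energy is at most that of `u`
at the same `r`. So `r → 0` is taken for each `n` first, and `n → ∞` only in the pairing with a
fixed field `φ`; the two limits are never exchanged. -/
theorem le_liminf_translationEnergy (hw : IsIsotropicWeight w K) (hK : K ≠ ⊤) (hum : Measurable u)
    (hu1 : ∀ x, |u x| ≤ 1) (huc : HasCompactSupport u) :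
    K * gradVariation u ≤ liminf (translationEnergy w u) (𝓝[>] 0) := by
  have hui := integrable_of_abs_le_one hum hu1 huc
  obtain ⟨ρ, hρ, hlim⟩ := exists_mollifier_seq hui.locallyIntegrable
  rw [gradVariation]
  simp_rw [ENNReal.mul_iSup]
  refine iSup₂_le fun φ hφ => ?_
  have hψ := continuous_divergence hφ.1
  have hψc := hasCompactSupport_divergence hφ.2.1
  have htend : Tendsto (fun n => ∫ x, mollify (ρ n) u x * divergence φ x) atTop
      (𝓝 (∫ x, u x * divergence φ x)) := by
    refine tendsto_integral_of_dominated_convergence (fun x => ‖divergence φ x‖) ?_ ?_ ?_ ?_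
    · intro n
      exact ((contDiff_mollify (hρ n) hui).continuous.mul hψ).aestronglyMeasurable
    · exact (hψ.integrable_of_hasCompactSupport hψc).norm
    · refine fun n => Eventually.of_forall fun x => ?_
      rw [norm_mul]
      exact mul_le_of_le_one_left (norm_nonneg _) (abs_mollify_le_one (hρ n) hu1 x)
    · filter_upwards [hlim] with x hx
      exact hx.mul_const _
  have hbound : ∀ n, K * ENNReal.ofReal |∫ x, mollify (ρ n) u x * divergence φ x| ≤
      liminf (translationEnergy w u) (𝓝[>] 0) := by
    intro n
    have h1 := (contDiff_mollify (hρ n) hui).of_le one_le_two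
    calc _ ≤ K * ∫⁻ x, ‖fderiv ℝ (mollify (ρ n) u) x‖ₑ := by
          gcongr
          refine le_trans ?_ (gradVariation_le_lintegral_fderiv h1)
          rw [← Real.norm_eq_abs, ofReal_norm]
          exact enorm_integral_mul_divergence_le _ hφ.1 hφ.2.1 hφ.2.2
      _ ≤ _ := le_liminf_translationEnergy_of_contDiff hw h1
      _ ≤ _ := liminf_le_liminf
          (Eventually.of_forall fun r => translationEnergy_mollify_le w (hρ n) hui hum r)
  have hcont : Tendsto (fun n => K * ENNReal.ofReal |∫ x, mollify (ρ n) u x * divergence φ x|)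
      atTop (𝓝 (K * ENNReal.ofReal |∫ x, u x * divergence φ x|)) := by
    exact ENNReal.Tendsto.const_mul (ENNReal.tendsto_ofReal htend.abs) (Or.inr hK)
  exact le_of_tendsto' hcont hbound

theorem tendsto_translationEnergy (hw : IsIsotropicWeight w K) (hK : K ≠ ⊤) (hum : Measurable u)
    (hu1 : ∀ x, |u x| ≤ 1) (huc : HasCompactSupport u) :
    Tendsto (translationEnergy w u) (𝓝[>] 0) (𝓝 (K * gradVariation u)) := by
  refine tendsto_of_le_liminf_of_limsup_le (le_liminf_translationEnergy hw hK hum hu1 huc) ?_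
  refine (limsup_le_limsup (v := fun _ => K * gradVariation u) ?_).trans_eq (limsup_const _)
  filter_upwards [self_mem_nhdsWithin] with r hr
  exact translationEnergy_le hw (integrable_of_abs_le_one hum hu1 huc) huc hr

end EnergyBounds

/-! ### Polar coordinates, dilations and rotational symmetry. -/

section PolarCoordinates

variable {E : Type*} [NormedAddCommGroup E] [InnerProductSpace ℝ E] [FiniteDimensional ℝ E]
  [MeasurableSpace E] [BorelSpace E]

theorem lintegral_eq_lintegral_sphere [Nontrivial E] {f : E → ℝ≥0∞} (hf : Measurable f) :
    ∫⁻ x, f x = ∫⁻ ω, ∫⁻ s in Ioi (0 : ℝ),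
      ENNReal.ofReal (s ^ (Module.finrank ℝ E - 1)) * f (s • (ω : E))
        ∂volume ∂((volume : Measure E).toSphere) := by
  have hg : Measurable fun p : Metric.sphere (0 : E) 1 × Ioi (0 : ℝ) =>
      f ((p.2 : ℝ) • (p.1 : E)) := by fun_prop
  calc ∫⁻ x, f x = ∫⁻ x : ({(0)}ᶜ : Set E), f x ∂(volume.comap Subtype.val) := by
        rw [lintegral_subtype_comap (measurableSet_singleton _).compl f, restrict_compl_singleton]
    _ = ∫⁻ p, f ((p.2 : ℝ) • (p.1 : E)) ∂(volume : Measure E).toSphere.prod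
          (.volumeIoiPow (Module.finrank ℝ E - 1)) := by
        rw [← (volume : Measure E).measurePreserving_homeomorphUnitSphereProd.lintegral_comp_emb
          (Homeomorph.measurableEmbedding _)]
        congr 1 with x
        rw [← homeomorphUnitSphereProd_symm_apply_coe, Homeomorph.symm_apply_apply]
    _ = _ := by
        rw [lintegral_prod _ hg.aemeasurable]
        congr 1 with ω
        have hω : Measurable fun s : ℝ => f (s • (ω : E)) := by fun_prop
        have hω' : Measurable fun s : Ioi (0 : ℝ) => f ((s : ℝ) • (ω : E)) :=
          hω.comp measurable_subtype_coe
        dsimp only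
        rw [Measure.volumeIoiPow, lintegral_withDensity_eq_lintegral_mul _ (by fun_prop) hω',
          ← lintegral_subtype_comap measurableSet_Ioi]
        rfl

theorem lintegral_comp_smul_pos {f : E → ℝ≥0∞} (hf : Measurable f) {r : ℝ} (hr : 0 < r) :
    ∫⁻ x, f x = ENNReal.ofReal (r ^ Module.finrank ℝ E) * ∫⁻ x, f (r • x) := by
  have h := lintegral_map hf (measurable_const_smul r) (μ := (volume : Measure E))
  rw [Measure.map_addHaar_smul _ hr.ne', lintegral_smul_measure] at h
  rw [← h, smul_eq_mul, ← mul_assoc, ← ENNReal.ofReal_mul (by positivity), abs_of_pos (by positivity),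
    mul_inv_cancel₀ (by positivity), ENNReal.ofReal_one, one_mul]

/-- The reflection in the hyperplane orthogonal to `e - e'` carries `e` to `e'` and preserves norms
and volume. -/
theorem lintegral_radial_mul_inner_eq {g : ℝ → ℝ≥0∞} {e e' : E} (he : ‖e‖ = 1) (he' : ‖e'‖ = 1) :
    ∫⁻ k, g ‖k‖ * ‖inner ℝ e k‖ₑ = ∫⁻ k, g ‖k‖ * ‖inner ℝ e' k‖ₑ := by
  let R := (ℝ ∙ (e - e'))ᗮ.reflection
  have hR : R e = e' := Submodule.reflection_sub (he.trans he'.symm)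
  rw [← R.measurePreserving.lintegral_comp_emb R.toHomeomorph.measurableEmbedding
    (fun k => g ‖k‖ * ‖inner ℝ e' k‖ₑ)]
  congr 1 with k
  rw [R.norm_map, ← hR, R.inner_map_map]

end PolarCoordinates

/-! ### The jump kernel, its isotropy constant, and the scaling identity. -/

section JumpKernel

variable {N : ℕ}

/-- The kernel `|h| ^ (γ - N)` restricted to the translations `h` with `t |h| ^ (1 + γ) < 1`. -/
def jumpKernel (N : ℕ) (γ t : ℝ) (h : EuclideanSpace ℝ (Fin N)) : ℝ≥0∞ :=
  if t * ‖h‖ ^ (1 + γ) < 1 then ENNReal.ofReal (‖h‖ ^ (γ - (N : ℝ))) else 0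

theorem measurable_jumpKernel (N : ℕ) (γ t : ℝ) : Measurable (jumpKernel N γ t) := by
  unfold jumpKernel
  refine Measurable.ite (measurableSet_lt (by fun_prop) measurable_const) (by fun_prop)
    measurable_const

/-- The condition cuts out `s > 1` if `γ < -1` and `s < 1` if `γ > -1`: in each case the side on
which `s^γ` is integrable. -/
theorem lintegral_rpow_of_rpow_lt_one {γ : ℝ} (hγ : γ ≠ -1) :
    ∫⁻ s in Ioi (0 : ℝ), (if 1 * s ^ (1 + γ) < 1 then ENNReal.ofReal (s ^ γ) else 0) =
      ENNReal.ofReal (1 / |γ + 1|) := by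
  simp_rw [one_mul]
  rcases lt_or_gt_of_ne hγ with h | h
  · have hset : ∀ s ∈ Ioi (0 : ℝ), (if s ^ (1 + γ) < 1 then ENNReal.ofReal (s ^ γ) else 0) =
        (Ioi (1 : ℝ)).indicator (fun s => ENNReal.ofReal (s ^ γ)) s := by
      intro s hs
      have : s ^ (1 + γ) < 1 ↔ 1 < s := by
        constructor
        · intro h1
          by_contra! h2
          exact absurd h1
            (not_lt.2 (Real.one_le_rpow_of_pos_of_le_one_of_nonpos hs h2 (by linarith)))
        · exact fun h1 => Real.rpow_lt_one_of_one_lt_of_neg h1 (by linarith)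
      simp only [indicator, mem_Ioi, this]
    rw [setLIntegral_congr_fun measurableSet_Ioi hset, setLIntegral_indicator measurableSet_Ioi,
      inter_eq_left.2 (Ioi_subset_Ioi zero_le_one),
      ← ofReal_integral_eq_lintegral_ofReal (integrableOn_Ioi_rpow_of_lt h one_pos)]
    · rw [integral_Ioi_rpow_of_lt h one_pos, Real.one_rpow, abs_of_neg (by linarith), div_neg,
        neg_div]
    · filter_upwards [ae_restrict_mem measurableSet_Ioi] with s hs
      exact Real.rpow_nonneg (zero_le_one.trans (le_of_lt hs)) _
  · have hset : ∀ s ∈ Ioi (0 : ℝ), (if s ^ (1 + γ) < 1 then ENNReal.ofReal (s ^ γ) else 0) =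
        (Iio (1 : ℝ)).indicator (fun s => ENNReal.ofReal (s ^ γ)) s := by
      intro s hs
      have : s ^ (1 + γ) < 1 ↔ s < 1 := by
        constructor
        · intro h1
          by_contra! h2
          exact absurd h1 (not_lt.2 (Real.one_le_rpow h2 (by linarith)))
        · exact fun h1 => Real.rpow_lt_one (le_of_lt hs) h1 (by linarith)
      simp only [indicator, mem_Iio, this]
    have hi : IntegrableOn (fun s : ℝ => s ^ γ) (Iio 1 ∩ Ioi 0) := by
      rw [inter_comm, Ioi_inter_Iio]
      exact ((intervalIntegrable_iff_integrableOn_Ioo_of_le zero_le_one).1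
        (intervalIntegral.intervalIntegrable_rpow' h))
    rw [setLIntegral_congr_fun measurableSet_Ioi hset, setLIntegral_indicator measurableSet_Iio,
      ← ofReal_integral_eq_lintegral_ofReal hi]
    · rw [inter_comm, Ioi_inter_Iio, ← integral_Ioc_eq_integral_Ioo,
        ← intervalIntegral.integral_of_le zero_le_one, integral_rpow (Or.inl h), Real.one_rpow,
        Real.zero_rpow (by linarith), sub_zero, abs_of_pos (by linarith)]
    · filter_upwards [ae_restrict_mem (measurableSet_Iio.inter measurableSet_Ioi)] with s hs
      exact Real.rpow_nonneg (le_of_lt hs.2) _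

theorem nontrivial_euclideanSpace (hN : 1 ≤ N) : Nontrivial (EuclideanSpace ℝ (Fin N)) := by
  have : Nonempty (Fin N) := ⟨⟨0, hN⟩⟩
  infer_instance

theorem lintegral_sphere_inner (e : EuclideanSpace ℝ (Fin N)) :
    ∫⁻ ω : Metric.sphere (0 : EuclideanSpace ℝ (Fin N)) 1,
      ‖inner ℝ e (ω : EuclideanSpace ℝ (Fin N))‖ₑ
        ∂((volume : Measure (EuclideanSpace ℝ (Fin N))).toSphere) =
      ENNReal.ofReal (kappa 1 e) := by
  have hc : Continuous fun ω : Metric.sphere (0 : EuclideanSpace ℝ (Fin N)) 1 =>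
      |inner ℝ e (ω : EuclideanSpace ℝ (Fin N))| := by fun_prop
  unfold kappa
  simp_rw [Real.rpow_one]
  rw [ofReal_integral_eq_lintegral_ofReal]
  · simp_rw [← Real.norm_eq_abs, ofReal_norm]
  · exact hc.integrable_of_hasCompactSupport (HasCompactSupport.of_compactSpace _)
  · exact Eventually.of_forall fun _ => abs_nonneg _

theorem lintegral_jumpKernel_mul_inner (hN : 1 ≤ N) {γ : ℝ} (hγ : γ ≠ -1)
    (e : EuclideanSpace ℝ (Fin N)) :
    ∫⁻ k, jumpKernel N γ 1 k * ‖inner ℝ e k‖ₑ = ENNReal.ofReal (kappa 1 e / |γ + 1|) := by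
  have := nontrivial_euclideanSpace hN
  have hm := measurable_jumpKernel N γ 1
  have hk : 0 ≤ kappa 1 e := integral_nonneg fun _ => by positivity
  rw [lintegral_eq_lintegral_sphere (by fun_prop), div_eq_mul_one_div, ENNReal.ofReal_mul hk,
    ← lintegral_sphere_inner, ← lintegral_rpow_of_rpow_lt_one hγ, ← lintegral_mul_const _ (by fun_prop)]
  congr 1 with ω
  rw [← lintegral_const_mul']
  swap
  · exact enorm_ne_top
  refine setLIntegral_congr_fun measurableSet_Ioi fun s hs => ?_
  have hs : 0 < s := hs
  have hω : ‖s • (ω : EuclideanSpace ℝ (Fin N))‖ = s := by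
    rw [norm_smul, norm_eq_of_mem_sphere, mul_one, Real.norm_of_nonneg hs.le]
  rw [jumpKernel, hω, inner_smul_right, enorm_mul, Real.enorm_of_nonneg hs.le,
    finrank_euclideanSpace_fin]
  split_ifs
  -- Exponents: `N - 1` from the Jacobian, `γ - N` from the kernel and `1` from the linear form add
  -- up to `γ`.
  · rw [← mul_assoc, ← mul_assoc, mul_comm _ ‖_‖ₑ, ← ENNReal.ofReal_mul (by positivity),
      ← ENNReal.ofReal_mul (by positivity), ← Real.rpow_natCast s, ← Real.rpow_add hs]
    congr 2
    rw [← Real.rpow_add_one hs.ne']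
    congr 1
    push_cast [hN]
    ring
  · simp

theorem isIsotropicWeight_jumpKernel (hN : 1 ≤ N) {γ : ℝ} (hγ : γ ≠ -1)
    {e : EuclideanSpace ℝ (Fin N)} (he : ‖e‖ = 1) :
    IsIsotropicWeight (jumpKernel N γ 1) (ENNReal.ofReal (kappa 1 e / |γ + 1|)) := by
  refine ⟨measurable_jumpKernel N γ 1, fun L => ?_⟩
  have hm := measurable_jumpKernel N γ 1
  obtain ⟨ξ, rfl⟩ := (InnerProductSpace.toDual ℝ (EuclideanSpace ℝ (Fin N))).surjective L
  simp only [InnerProductSpace.toDual_apply_apply]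
  rcases eq_or_ne ξ 0 with rfl | hξ
  · simp [← ofReal_norm]
  have hn : ‖ξ‖ ≠ 0 := norm_ne_zero_iff.2 hξ
  have he' : ‖(‖ξ‖⁻¹ : ℝ) • ξ‖ = 1 := norm_smul_inv_norm (𝕜 := ℝ) hξ
  have hr := lintegral_radial_mul_inner_eq
    (g := fun s => if 1 * s ^ (1 + γ) < 1 then ENNReal.ofReal (s ^ (γ - (N : ℝ))) else 0) he' he
  change ∫⁻ k, jumpKernel N γ 1 k * _ = ∫⁻ k, jumpKernel N γ 1 k * _ at hr
  rw [lintegral_jumpKernel_mul_inner hN hγ e] at hr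
  have hL : ‖InnerProductSpace.toDual ℝ (EuclideanSpace ℝ (Fin N)) ξ‖ₑ = ‖ξ‖ₑ := by
    rw [← ofReal_norm, LinearIsometryEquiv.norm_map, ofReal_norm]
  rw [← hr, hL, ← lintegral_mul_const _ (by fun_prop)]
  congr 1 with k
  rw [mul_assoc, inner_smul_left, enorm_mul, mul_right_comm]
  congr 1
  have : ‖(starRingEnd ℝ) ‖ξ‖⁻¹‖ₑ * ‖ξ‖ₑ = 1 := by
    rw [← enorm_norm ξ, ← enorm_mul]
    simp [hn]
  rw [this, one_mul]

theorem enorm_sub_indicator_one {α : Type*} (s : Set α) (x y : α) :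
    ‖s.indicator (fun _ => (1 : ℝ)) x - s.indicator (fun _ => 1) y‖ₑ =
      if s.indicator (fun _ => (1 : ℝ)) x = s.indicator (fun _ => 1) y then 0 else 1 := by
  by_cases hx : x ∈ s <;> by_cases hy : y ∈ s <;> simp [hx, hy]

/-- Substitute `x = y + h` and use Tonelli. A jump has size exactly 1, so the threshold becomes a
condition on `h` alone. -/
theorem nuMeasure_superlevelSet {Ω : Set (EuclideanSpace ℝ (Fin N))} (hΩ : MeasurableSet Ω)
    (γ : ℝ) {t : ℝ} (ht : 0 < t) :
    nuMeasure N γ (superlevelSet t γ (Ω.indicator fun _ => 1)) =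
      ∫⁻ h, jumpKernel N γ t h * translationDefect (Ω.indicator fun _ => 1) h := by
  set u : EuclideanSpace ℝ (Fin N) → ℝ := Ω.indicator fun _ => 1 with hu
  have hum : Measurable u := measurable_const.indicator hΩ
  have hjm := measurable_jumpKernel N γ t
  have hD : MeasurableSet {z : EuclideanSpace ℝ (Fin N) × EuclideanSpace ℝ (Fin N) |
      z.1 ≠ z.2} := (measurableSet_eq_fun measurable_fst measurable_snd).compl
  have hS : MeasurableSet (superlevelSet t γ u) := by
    have hq : Measurable fun z : EuclideanSpace ℝ (Fin N) × EuclideanSpace ℝ (Fin N) =>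
        |diffQuot γ u z.1 z.2| := by
      unfold diffQuot
      fun_prop
    exact hD.inter (measurableSet_lt measurable_const hq)
  have hsub : superlevelSet t γ u ⊆ {z | z.1 ≠ z.2} := fun z hz => hz.1
  have hfm : Measurable fun z : EuclideanSpace ℝ (Fin N) × EuclideanSpace ℝ (Fin N) =>
      ENNReal.ofReal (‖z.1 - z.2‖ ^ (γ - (N : ℝ))) := by fun_prop
  rw [nuMeasure, withDensity_apply _ hS, Measure.restrict_restrict hS, inter_eq_left.2 hsub,
    ← lintegral_indicator hS, Measure.volume_eq_prod,
    lintegral_prod_symm _ (hfm.indicator hS).aemeasurable]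
  calc _ = ∫⁻ y, ∫⁻ h, jumpKernel N γ t h * ‖u (y + h) - u y‖ₑ := by
        congr 1 with y
        rw [← lintegral_add_left_eq_self _ y]
        congr 1 with h
        simp only [indicator, superlevelSet, mem_ofPred_eq, diffQuot, add_sub_cancel_left, jumpKernel]
        rcases eq_or_ne h 0 with rfl | hh
        · simp
        have hpos : 0 < ‖h‖ ^ (1 + γ) := Real.rpow_pos_of_pos (norm_pos_iff.2 hh) _
        rw [enorm_sub_indicator_one]
        by_cases heq : Ω.indicator (fun _ => (1 : ℝ)) (y + h) = Ω.indicator (fun _ => 1) y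
        · simp [hu, heq, ht.le]
        · have habs : |u (y + h) - u y| = 1 := by
            by_cases hx : y + h ∈ Ω <;> by_cases hy : y ∈ Ω <;> simp_all [indicator]
          have hiff : t < |(u (y + h) - u y) / ‖h‖ ^ (1 + γ)| ↔ t * ‖h‖ ^ (1 + γ) < 1 := by
            rw [abs_div, habs, abs_of_pos hpos, lt_div_iff₀ hpos]
          simp [heq, hh, hiff]
    _ = ∫⁻ h, ∫⁻ y, jumpKernel N γ t h * ‖u (y + h) - u y‖ₑ := by
        apply lintegral_lintegral_swap
        apply Measurable.aemeasurable
        unfold Function.uncurry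
        fun_prop
    _ = _ := by
        congr 1 with h
        rw [lintegral_const_mul _ (by fun_prop)]
        rfl

/-- Under `h = r k` the kernel cutoff loses its dependence on `r`, and the powers `-(1+γ)`, `N` and
`γ - N` of `r` sum to `-1`, the denominator of the difference quotient. -/
theorem mul_nuMeasure_superlevelSet {Ω : Set (EuclideanSpace ℝ (Fin N))} (hΩ : MeasurableSet Ω)
    (γ : ℝ) {r : ℝ} (hr : 0 < r) :
    ENNReal.ofReal (r ^ (-(1 + γ))) *
        nuMeasure N γ (superlevelSet (r ^ (-(1 + γ))) γ (Ω.indicator fun _ => 1)) =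
      translationEnergy (jumpKernel N γ 1) (Ω.indicator fun _ => 1) r := by
  have hum : Measurable (Ω.indicator fun _ => (1 : ℝ)) := measurable_const.indicator hΩ
  have hT := measurable_translationDefect hum
  have hjm := measurable_jumpKernel N γ (r ^ (-(1 + γ)))
  rw [nuMeasure_superlevelSet hΩ γ (by positivity), lintegral_comp_smul_pos (by fun_prop) hr,
    finrank_euclideanSpace_fin, ← mul_assoc, ← lintegral_const_mul _ (by fun_prop),
    translationEnergy]
  congr 1 with k
  have h1 : ‖r • k‖ = r * ‖k‖ := by rw [norm_smul, Real.norm_of_nonneg hr.le]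
  have h2 : r ^ (-(1 + γ)) * (r * ‖k‖) ^ (1 + γ) = 1 * ‖k‖ ^ (1 + γ) := by
    rw [Real.mul_rpow hr.le (norm_nonneg _), ← mul_assoc, ← Real.rpow_add hr]
    simp
  rw [jumpKernel, jumpKernel, h1, h2]
  split_ifs
  · rw [Real.mul_rpow hr.le (norm_nonneg _), ← mul_assoc, ← ENNReal.ofReal_mul (by positivity),
      ← ENNReal.ofReal_mul (by positivity), div_eq_mul_inv, ← ENNReal.ofReal_inv_of_pos hr,
      mul_comm (translationDefect _ _), ← mul_assoc (ENNReal.ofReal _),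
      ← ENNReal.ofReal_mul (by positivity)]
    congr 2
    rw [← Real.rpow_natCast, ← Real.rpow_add hr, ← mul_assoc, ← Real.rpow_add hr, mul_comm,
      ← Real.rpow_neg_one r]
    congr 2
    ring
  · simp

end JumpKernel

/-! ### Linear bound on the `L¹` modulus of a smooth bounded domain. -/

section TranslatesOfSmoothDomains

variable {N : ℕ}

theorem exists_ball_linear_approx {ρ : EuclideanSpace ℝ (Fin N) → ℝ}
    {p : EuclideanSpace ℝ (Fin N)} {D : EuclideanSpace ℝ (Fin N) →L[ℝ] ℝ}
    (hρ : HasStrictFDerivAt ρ D p) {η : ℝ} (hη : 0 < η) :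
    ∃ δ > 0, ∀ x ∈ Metric.ball p δ, ∀ y ∈ Metric.ball p δ,
      |ρ x - ρ y - D (x - y)| ≤ η * ‖x - y‖ := by
  have h := hρ.isLittleO.def hη
  obtain ⟨δ, hδ, hb⟩ := Metric.eventually_nhds_iff_ball.1 h
  refine ⟨δ, hδ, fun x hx y hy => hb (x, y) ?_⟩
  rw [← ball_prod_same]
  exact ⟨hx, hy⟩

/-- A packing bound: `n` disjoint translates of `S` fit into one ball. It replaces a boundary chart
and Fubini in estimating the volume of a thin layer. -/
theorem volume_le_of_pairwise_disjoint_translates {S : Set (EuclideanSpace ℝ (Fin N))}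
    (hS : MeasurableSet S) {p τ : EuclideanSpace ℝ (Fin N)} {δ R : ℝ}
    (hSb : S ⊆ Metric.ball p δ) (n : ℕ)
    (hdisj : ∀ x ∈ S, ∀ y ∈ S, ∀ m : ℕ, 0 < m → x ≠ y + (m : ℝ) • τ)
    (hR : δ + n * ‖τ‖ ≤ R) :
    n * volume S ≤ volume (Metric.ball p R) := by
  let T : ℕ → Set (EuclideanSpace ℝ (Fin N)) := fun j => (fun x => x + (-((j : ℝ) • τ))) ⁻¹' S
  have hTm : ∀ j, MeasurableSet (T j) := fun j => hS.preimage (measurable_add_const _)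
  have hTv : ∀ j, volume (T j) = volume S := fun j => measure_preimage_add_right _ _ _
  have hlt : ∀ i j : ℕ, i < j → Disjoint (T i) (T j) := by
    intro i j hij
    refine Set.disjoint_left.2 fun z hzi hzj => ?_
    refine hdisj _ hzi _ hzj (j - i) (Nat.sub_pos_of_lt hij) ?_
    rw [Nat.cast_sub hij.le, sub_smul]
    module
  have hpd : Pairwise (Function.onFun Disjoint T) := by
    intro i j hij
    rcases lt_or_gt_of_ne hij with h | h
    · exact hlt i j h
    · exact (hlt j i h).symm
  calc n * volume S = ∑ j ∈ Finset.range n, volume (T j) := by simp [hTv]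
    _ = volume (⋃ j ∈ Finset.range n, T j) :=
        (measure_biUnion_finset (fun i _ j _ hij => hpd hij) fun j _ => hTm j).symm
    _ ≤ volume (Metric.ball p R) := by
        refine measure_mono (iUnion₂_subset fun j hj z hz => ?_)
        have hz' := Metric.mem_ball.1 (hSb hz)
        rw [Metric.mem_ball]
        rw [dist_eq_norm] at hz' ⊢
        have hjn : (j : ℝ) ≤ n := by exact_mod_cast (Finset.mem_range.1 hj).le
        have h1 : ‖z - p‖ ≤ ‖z + -((j : ℝ) • τ) - p‖ + ‖(j : ℝ) • τ‖ := by
          have : z - p = (z + -((j : ℝ) • τ) - p) + (j : ℝ) • τ := by abel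
          conv_lhs => rw [this]
          exact norm_add_le _ _
        rw [norm_smul, Real.norm_natCast] at h1
        have h2 := mul_le_mul_of_nonneg_right hjn (norm_nonneg τ)
        linarith

/-- Points leaving `Ω` under `h` lie in the layer `-M‖h‖ ≤ ρ < 0`. A shift by `σ v`, with `σ`
proportional to `‖h‖` and `v` transversal to the boundary, raises `ρ` by at least the thickness of
the layer. So multiples of this shift give disjoint copies, and about `1/‖h‖` of them stay in a
fixed ball. -/
theorem exists_local_exit_bound {Ω : Set (EuclideanSpace ℝ (Fin N))} (hΩ : IsOpen Ω)
    (hsm : HasSmoothBoundary Ω) {p : EuclideanSpace ℝ (Fin N)} (hp : p ∈ frontier Ω) :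
    ∃ δ > 0, ∃ C : ℝ≥0∞, C ≠ ⊤ ∧ ∀ h, ‖h‖ < δ →
      volume {x | x ∈ Metric.ball p δ ∧ x ∈ Ω ∧ x + h ∉ Ω} ≤ C * ‖h‖ₑ := by
  obtain ⟨U, ρ, hU, hpU, hρ, hD, hΩU⟩ := hsm p hp
  have hstrict : HasStrictFDerivAt ρ (fderiv ℝ ρ p) p :=
    (hρ.contDiffAt (hU.mem_nhds hpU)).hasStrictFDerivAt (by simp)
  set D := fderiv ℝ ρ p with hDdef
  obtain ⟨v, hv⟩ : ∃ v, 0 < D v := by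
    obtain ⟨v, hv⟩ := DFunLike.ne_iff.1 hD
    rcases lt_or_gt_of_ne hv with h | h
    · exact ⟨-v, by simpa using h⟩
    · exact ⟨v, by simpa using h⟩
  have hv0 : 0 < ‖v‖ := norm_pos_iff.2 fun h => by simp [h] at hv
  -- With this `η` the linearization error along `v` is at most half of the main term.
  set η := D v / (2 * ‖v‖) with hη
  have hηpos : 0 < η := by positivity
  obtain ⟨δ₁, hδ₁, happ⟩ := exists_ball_linear_approx hstrict hηpos
  obtain ⟨δ₂, hδ₂, hball⟩ := Metric.isOpen_iff.1 hU p hpU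
  set M := ‖D‖ + η with hM
  have hMpos : 0 < M := by positivity
  set δ := min (min (δ₁ / 2) (δ₂ / 2)) 1 with hδ
  have hδpos : 0 < δ := by positivity
  have hδ1 : 2 * δ ≤ δ₁ := by
    have : δ ≤ δ₁ / 2 := (min_le_left _ _).trans (min_le_left _ _)
    linarith
  have hδ2 : 2 * δ ≤ δ₂ := by
    have : δ ≤ δ₂ / 2 := (min_le_left _ _).trans (min_le_right _ _)
    linarith
  have hδ3 : δ ≤ 1 := min_le_right _ _
  set R := δ + 4 * M / D v * ‖v‖ with hR
  refine ⟨δ, hδpos, volume (Metric.ball p R), measure_ball_lt_top.ne, fun h hh => ?_⟩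
  rcases eq_or_ne h 0 with rfl | h0
  · simp
  have hhpos : 0 < ‖h‖ := norm_pos_iff.2 h0
  set S := {x | x ∈ Metric.ball p δ ∧ x ∈ Ω ∧ x + h ∉ Ω} with hS
  have hSm : MeasurableSet S := by
    refine Metric.isOpen_ball.measurableSet.inter (hΩ.measurableSet.inter ?_)
    exact hΩ.measurableSet.compl.preimage (measurable_add_const h)
  have hx2 : ∀ x ∈ S, x ∈ Metric.ball p (2 * δ) ∧ x + h ∈ Metric.ball p (2 * δ) := by
    intro x hx
    have hxb := Metric.mem_ball.1 hx.1
    rw [dist_eq_norm] at hxb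
    refine ⟨Metric.ball_subset_ball (by linarith) hx.1, ?_⟩
    rw [Metric.mem_ball, dist_eq_norm, add_sub_right_comm]
    linarith [norm_add_le (x - p) h]
  have hneg : ∀ x ∈ S, ρ x < 0 := by
    intro x hx
    have : x ∈ Ω ∩ U :=
      ⟨hx.2.1, hball (Metric.ball_subset_ball hδ2 (hx2 x hx).1)⟩
    rw [hΩU] at this
    exact this.2
  have hlow : ∀ x ∈ S, -(M * ‖h‖) ≤ ρ x := by
    intro x hx
    have hU' : x + h ∈ U := hball (Metric.ball_subset_ball hδ2 (hx2 x hx).2)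
    have hpos : 0 ≤ ρ (x + h) := by
      by_contra! hlt
      have : x + h ∈ Ω ∩ U := by
        rw [hΩU]
        exact ⟨hU', hlt⟩
      exact hx.2.2 this.1
    have h1 := (abs_le.1 (happ _ (Metric.ball_subset_ball hδ1 (hx2 x hx).2) _
      (Metric.ball_subset_ball hδ1 (hx2 x hx).1))).2
    rw [add_sub_cancel_left] at h1
    have h2 := (le_abs_self _).trans (D.le_opNorm h)
    have h3 : M * ‖h‖ = ‖D‖ * ‖h‖ + η * ‖h‖ := by rw [hM]; ring
    linarith
  -- Half of `σ * D v` is `M * ‖h‖`, the thickness of the layer.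
  set σ := 2 * M * ‖h‖ / D v with hσ
  have hσpos : 0 < σ := by positivity
  have hdisj : ∀ x ∈ S, ∀ y ∈ S, ∀ m : ℕ, 0 < m → x ≠ y + (m : ℝ) • (σ • v) := by
    intro x hx y hy m hm hxy
    have h1 := (abs_le.1 (happ _ (Metric.ball_subset_ball hδ1 (hx2 x hx).1) _
      (Metric.ball_subset_ball hδ1 (hx2 y hy).1))).1
    have hxy' : x - y = ((m : ℝ) * σ) • v := by rw [hxy, smul_smul]; abel
    have hm1 : (1 : ℝ) ≤ m := by exact_mod_cast hm
    rw [hxy', map_smul, smul_eq_mul, norm_smul, Real.norm_of_nonneg (by positivity)] at h1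
    have h2 : η * (m * σ * ‖v‖) = m * σ * D v / 2 := by
      rw [hη]
      field_simp
    have h3 : σ * D v = 2 * M * ‖h‖ := by
      rw [hσ]
      field_simp
    have h4 : 2 * M * ‖h‖ ≤ m * σ * D v := by
      rw [mul_assoc (m : ℝ), h3]
      exact le_mul_of_one_le_left (by positivity) hm1
    linarith [hneg x hx, hlow y hy]
  -- Since `‖h‖ < δ ≤ 1`, rounding up keeps `n * ‖h‖ ≤ 2`; hence the factor 4 in `R`.
  set n := ⌈1 / ‖h‖⌉₊ with hn
  have hn1 : 1 / ‖h‖ ≤ n := Nat.le_ceil _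
  have hn2 : (n : ℝ) * ‖h‖ ≤ 2 := by
    have : (n : ℝ) < 1 / ‖h‖ + 1 := Nat.ceil_lt_add_one (by positivity)
    have h5 : (1 / ‖h‖ + 1) * ‖h‖ = 1 + ‖h‖ := by field_simp
    nlinarith
  have hkey := volume_le_of_pairwise_disjoint_translates hSm (fun x hx => hx.1) n hdisj
    (R := R) (by
      rw [norm_smul, Real.norm_of_nonneg hσpos.le, hR]
      have : (n : ℝ) * (σ * ‖v‖) = (n * ‖h‖) * (2 * M / D v * ‖v‖) := by
        rw [hσ]
        ring
      have h6 : 4 * M / D v * ‖v‖ = 2 * (2 * M / D v * ‖v‖) := by ring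
      rw [this, h6]
      gcongr)
  calc volume S = (ENNReal.ofReal (1 / ‖h‖) * volume S) * ‖h‖ₑ := by
        rw [mul_right_comm, ← ofReal_norm, ← ENNReal.ofReal_mul (by positivity),
          one_div_mul_cancel hhpos.ne', ENNReal.ofReal_one, one_mul]
    _ ≤ (n * volume S) * ‖h‖ₑ := by
        gcongr
        rw [← ENNReal.ofReal_natCast]
        exact ENNReal.ofReal_le_ofReal hn1
    _ ≤ _ := by gcongr

theorem exists_mem_frontier_of_isPreconnected {X : Type*} [TopologicalSpace X] {s t : Set X}
    (hs : IsPreconnected s) (ht : IsOpen t) {x y : X} (hx : x ∈ s) (hxt : x ∈ t) (hy : y ∈ s)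
    (hyt : y ∉ t) : ∃ q ∈ s, q ∈ frontier t := by
  by_contra! hno
  have hsplit : ∀ z ∈ s, z ∉ t → z ∈ (closure t)ᶜ := by
    intro z hz hzt hzc
    exact hno z hz (by rw [ht.frontier_eq]; exact ⟨hzc, hzt⟩)
  obtain ⟨z, -, hz, hz'⟩ := hs t (closure t)ᶜ ht isClosed_closure.isOpen_compl
    (fun z hz => or_iff_not_imp_left.2 (hsplit z hz)) ⟨x, hx, hxt⟩ ⟨y, hy, hsplit y hy hyt⟩
  exact hz' (subset_closure hz)

theorem exists_exit_bound {Ω : Set (EuclideanSpace ℝ (Fin N))} (hΩ : IsBoundedSmoothDomain Ω) :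
    ∃ δ > 0, ∃ C : ℝ≥0∞, C ≠ ⊤ ∧ ∀ h, ‖h‖ < δ →
      volume {x | x ∈ Ω ∧ x + h ∉ Ω} ≤ C * ‖h‖ₑ := by
  have hcpt : IsCompact (frontier Ω) :=
    Metric.isCompact_of_isClosed_isBounded isClosed_frontier
      (hΩ.isBounded.closure.subset frontier_subset_closure)
  -- Restricting to `x` within `‖h‖` of a set of boundary points gives a property stable under
  -- subsets and finite unions, so compactness of the boundary applies. The restriction is harmless:
  -- the segment from `x` to `x + h` meets the boundary.
  have hcover : ∃ δ > 0, ∃ C : ℝ≥0∞, C ≠ ⊤ ∧ ∀ h, ‖h‖ < δ →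
      volume {x | (∃ q ∈ frontier Ω, ‖x - q‖ ≤ ‖h‖) ∧ x ∈ Ω ∧ x + h ∉ Ω} ≤ C * ‖h‖ₑ := by
    refine hcpt.induction_on (p := fun s => ∃ δ > 0, ∃ C : ℝ≥0∞, C ≠ ⊤ ∧ ∀ h, ‖h‖ < δ →
      volume {x | (∃ q ∈ s, ‖x - q‖ ≤ ‖h‖) ∧ x ∈ Ω ∧ x + h ∉ Ω} ≤ C * ‖h‖ₑ) ?_ ?_ ?_ ?_
    · exact ⟨1, one_pos, 0, by simp, fun h _ => by simp⟩
    · rintro s t hst ⟨δ, hδ, C, hC, hb⟩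
      refine ⟨δ, hδ, C, hC, fun h hh => (measure_mono ?_).trans (hb h hh)⟩
      rintro x ⟨⟨q, hq, hxq⟩, hx⟩
      exact ⟨⟨q, hst hq, hxq⟩, hx⟩
    · rintro s t ⟨δ, hδ, C, hC, hb⟩ ⟨δ', hδ', C', hC', hb'⟩
      refine ⟨min δ δ', lt_min hδ hδ', C + C', by finiteness, fun h hh => ?_⟩
      have h1 := hb h (hh.trans_le (min_le_left _ _))
      have h2 := hb' h (hh.trans_le (min_le_right _ _))
      rw [add_mul]
      refine (measure_mono ?_).trans ((measure_union_le _ _).trans (add_le_add h1 h2))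
      rintro x ⟨⟨q, hq | hq, hxq⟩, hx⟩
      · exact Or.inl ⟨⟨q, hq, hxq⟩, hx⟩
      · exact Or.inr ⟨⟨q, hq, hxq⟩, hx⟩
    · intro p hp
      obtain ⟨δ, hδ, C, hC, hb⟩ := exists_local_exit_bound hΩ.isOpen hΩ.smoothBoundary hp
      refine ⟨Metric.ball p (δ / 2), mem_nhdsWithin_of_mem_nhds (Metric.ball_mem_nhds p (by positivity)),
        δ / 2, by positivity, C, hC, fun h hh => ?_⟩
      refine (measure_mono ?_).trans (hb h (by linarith))
      rintro x ⟨⟨q, hq, hxq⟩, hx⟩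
      refine ⟨?_, hx⟩
      rw [Metric.mem_ball, dist_eq_norm] at hq ⊢
      have := norm_add_le (x - q) (q - p)
      rw [sub_add_sub_cancel] at this
      linarith
  obtain ⟨δ, hδ, C, hC, hb⟩ := hcover
  refine ⟨δ, hδ, C, hC, fun h hh => (measure_mono ?_).trans (hb h hh)⟩
  rintro x ⟨hx, hxh⟩
  refine ⟨?_, hx, hxh⟩
  have hpre : IsPreconnected (segment ℝ x (x + h)) := (convex_segment _ _).isPreconnected
  obtain ⟨q, hq, hqf⟩ := exists_mem_frontier_of_isPreconnected hpre hΩ.isOpen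
    (left_mem_segment ℝ _ _) hx (right_mem_segment ℝ _ _) hxh
  refine ⟨q, hqf, ?_⟩
  rw [segment_eq_image'] at hq
  obtain ⟨θ, hθ, rfl⟩ := hq
  simp only [add_sub_cancel_left, sub_add_cancel_left, norm_neg, norm_smul]
  rw [Real.norm_of_nonneg hθ.1]
  exact mul_le_of_le_one_left (norm_nonneg _) hθ.2

/-- Either `x` exits under `h`, or `x + h` exits under `-h`; translation invariance removes the
shift in the second case. -/
theorem translationDefect_indicator_le {Ω : Set (EuclideanSpace ℝ (Fin N))} (hΩ : IsOpen Ω)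
    (h : EuclideanSpace ℝ (Fin N)) :
    translationDefect (Ω.indicator fun _ => 1) h ≤
      volume {x | x ∈ Ω ∧ x + h ∉ Ω} + volume {x | x ∈ Ω ∧ x + -h ∉ Ω} := by
  have hm : ∀ h, MeasurableSet {x | x ∈ Ω ∧ x + h ∉ Ω} := fun h =>
    hΩ.measurableSet.inter (hΩ.measurableSet.compl.preimage (measurable_add_const h))
  have hshift : volume {x | x ∈ Ω ∧ x + -h ∉ Ω} =
      volume ((fun x => x + h) ⁻¹' {x | x ∈ Ω ∧ x + -h ∉ Ω}) :=
    (measure_preimage_add_right _ _ _).symm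
  rw [hshift, ← lintegral_indicator_one (hm h),
    ← lintegral_indicator_one ((hm (-h)).preimage (measurable_add_const h)),
    ← lintegral_add_left (measurable_one.indicator (hm h))]
  refine lintegral_mono fun x => ?_
  by_cases hx : x ∈ Ω <;> by_cases hy : x + h ∈ Ω <;> simp [hx, hy]

theorem exists_translationDefect_bound {Ω : Set (EuclideanSpace ℝ (Fin N))}
    (hΩ : IsBoundedSmoothDomain Ω) :
    ∃ δ > 0, ∃ C : ℝ≥0∞, C ≠ ⊤ ∧ ∀ h, ‖h‖ < δ →
      translationDefect (Ω.indicator fun _ => 1) h ≤ C * ‖h‖ₑ := by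
  obtain ⟨δ, hδ, C, hC, hb⟩ := exists_exit_bound hΩ
  refine ⟨δ, hδ, C + C, by finiteness, fun h hh => ?_⟩
  have h2 := hb (-h) (by rwa [norm_neg])
  rw [enorm_neg] at h2
  rw [add_mul]
  exact (translationDefect_indicator_le hΩ.isOpen h).trans (add_le_add (hb h hh) h2)

end TranslatesOfSmoothDomains

/-! ### Limits for characteristic functions and the exceptional ranges of `γ`. -/

section IndicatorLimits

variable {N : ℕ}

theorem exists_norm_eq_one (hN : 1 ≤ N) : ∃ e : EuclideanSpace ℝ (Fin N), ‖e‖ = 1 :=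
  ⟨EuclideanSpace.single ⟨0, hN⟩ 1, by simp⟩

theorem kappa_one_pos {e : EuclideanSpace ℝ (Fin N)} (he : ‖e‖ = 1) : 0 < kappa 1 e := by
  have : Nontrivial (EuclideanSpace ℝ (Fin N)) :=
    ⟨e, 0, fun h => by simp [h] at he⟩
  unfold kappa
  simp_rw [Real.rpow_one]
  have hc : Continuous fun ω : Metric.sphere (0 : EuclideanSpace ℝ (Fin N)) 1 =>
      |inner ℝ e (ω : EuclideanSpace ℝ (Fin N))| := by fun_prop
  refine hc.integral_pos_of_hasCompactSupport_nonneg_nonzero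
    (HasCompactSupport.of_compactSpace _) (fun _ => abs_nonneg _) (x := ⟨e, by simpa using he⟩) ?_
  simp [he]

theorem lintegral_jumpKernel_mul_enorm_ne_top (hN : 1 ≤ N) {γ : ℝ} (hγ : γ ≠ -1) :
    ∫⁻ k, jumpKernel N γ 1 k * ‖k‖ₑ ≠ ⊤ := by
  have hm := measurable_jumpKernel N γ 1
  have hle : ∀ k : EuclideanSpace ℝ (Fin N), ‖k‖ₑ ≤
      ∑ i, ‖inner ℝ (EuclideanSpace.single i (1 : ℝ)) k‖ₑ := by
    intro k
    conv_lhs => rw [← (EuclideanSpace.basisFun (Fin N) ℝ).sum_repr k]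
    refine (enorm_sum_le _ _).trans (Finset.sum_le_sum fun i _ => ?_)
    rw [enorm_smul]
    simp [EuclideanSpace.inner_single_left, ← ofReal_norm]
  refine ne_top_of_le_ne_top (b := ∑ i : Fin N,
    ∫⁻ k, jumpKernel N γ 1 k * ‖inner ℝ (EuclideanSpace.single i (1 : ℝ)) k‖ₑ) ?_ ?_
  · refine ENNReal.sum_ne_top.2 fun i _ => ?_
    rw [lintegral_jumpKernel_mul_inner hN hγ]
    exact ENNReal.ofReal_ne_top
  · rw [← lintegral_finsetSum _ fun i _ => by fun_prop]
    refine lintegral_mono fun k => ?_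
    dsimp only
    rw [← Finset.mul_sum]
    gcongr
    exact hle k

theorem hasCompactSupport_indicator_of_isBounded {Ω : Set (EuclideanSpace ℝ (Fin N))}
    (hΩ : Bornology.IsBounded Ω) : HasCompactSupport (Ω.indicator fun _ => (1 : ℝ)) :=
  HasCompactSupport.of_support_subset_isCompact hΩ.isCompact_closure
    (support_indicator_subset.trans subset_closure)

theorem abs_indicator_one_le {α : Type*} (s : Set α) (x : α) :
    |s.indicator (fun _ => (1 : ℝ)) x| ≤ 1 := by
  by_cases hx : x ∈ s <;> simp [hx]

theorem integrable_indicator_of_isBounded {Ω : Set (EuclideanSpace ℝ (Fin N))}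
    (hΩ : IsOpen Ω) (hb : Bornology.IsBounded Ω) :
    Integrable (Ω.indicator fun _ => (1 : ℝ)) :=
  integrable_of_abs_le_one (measurable_const.indicator hΩ.measurableSet) (abs_indicator_one_le Ω)
    (hasCompactSupport_indicator_of_isBounded hb)

theorem tendsto_translationEnergy_indicator (hN : 1 ≤ N) {Ω : Set (EuclideanSpace ℝ (Fin N))}
    (hΩ : IsOpen Ω) (hb : Bornology.IsBounded Ω) {γ : ℝ} (hγ : γ ≠ -1)
    {e : EuclideanSpace ℝ (Fin N)} (he : ‖e‖ = 1) :
    Tendsto (translationEnergy (jumpKernel N γ 1) (Ω.indicator fun _ => 1)) (𝓝[>] 0)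
      (𝓝 (ENNReal.ofReal (kappa 1 e / |γ + 1|) * gradVariation (Ω.indicator fun _ => 1))) :=
  tendsto_translationEnergy (isIsotropicWeight_jumpKernel hN hγ he) ENNReal.ofReal_ne_top
    (measurable_const.indicator hΩ.measurableSet) (abs_indicator_one_le Ω)
    (hasCompactSupport_indicator_of_isBounded hb)

/-- The limit theorem is read backwards at `γ = 0`: that kernel lives in the unit ball, so the
linear bound on translates controls the energies for small `r`. Their limit `K ‖∇u‖` is therefore
finite, and `K > 0`. -/
theorem gradVariation_indicator_lt_top (hN : 1 ≤ N) {Ω : Set (EuclideanSpace ℝ (Fin N))}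
    (hΩ : IsBoundedSmoothDomain Ω) : gradVariation (Ω.indicator fun _ => 1) < ⊤ := by
  obtain ⟨e, he⟩ := exists_norm_eq_one hN
  obtain ⟨δ, hδ, C, hC, hbound⟩ := exists_translationDefect_bound hΩ
  have h0 : (0 : ℝ) ≠ -1 := by norm_num
  have hm := measurable_jumpKernel N 0 1
  have htend := tendsto_translationEnergy_indicator hN hΩ.isOpen hΩ.isBounded h0 he
  have hle : ∀ᶠ r in 𝓝[>] (0 : ℝ),
      translationEnergy (jumpKernel N 0 1) (Ω.indicator fun _ => 1) r ≤
        C * ∫⁻ k, jumpKernel N 0 1 k * ‖k‖ₑ := by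
    filter_upwards [Ioo_mem_nhdsGT hδ] with r hr
    rw [← lintegral_const_mul _ (by fun_prop)]
    refine lintegral_mono fun k => ?_
    dsimp only
    by_cases hk : ‖k‖ < 1
    · have hrk : ‖r • k‖ < δ := by
        rw [norm_smul, Real.norm_of_nonneg hr.1.le]
        exact (mul_le_of_le_one_right hr.1.le hk.le).trans_lt hr.2
      rw [mul_left_comm]
      gcongr
      refine ENNReal.div_le_of_le_mul ((hbound _ hrk).trans_eq ?_)
      rw [enorm_smul, Real.enorm_of_nonneg hr.1.le, mul_comm (ENNReal.ofReal r), mul_assoc]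
    · simp [jumpKernel, hk]
  have hfin := (le_of_tendsto htend hle).trans_lt
    (ENNReal.mul_lt_top hC.lt_top (lintegral_jumpKernel_mul_enorm_ne_top hN h0).lt_top)
  refine lt_top_iff_ne_top.2 fun htop => ?_
  rw [htop, ENNReal.mul_top] at hfin
  · exact absurd hfin (lt_irrefl _)
  · have := kappa_one_pos he
    simpa using this

theorem gradVariation_indicator_pos (hN : 1 ≤ N) {Ω : Set (EuclideanSpace ℝ (Fin N))}
    (hΩ : IsOpen Ω) (hb : Bornology.IsBounded Ω) (hne : Ω.Nonempty) :
    0 < gradVariation (Ω.indicator fun _ => 1) := by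
  obtain ⟨R, hR, hΩR⟩ := hb.subset_ball_lt 0 (0 : EuclideanSpace ℝ (Fin N))
  let f : ContDiffBump (0 : EuclideanSpace ℝ (Fin N)) := ⟨R, R + 1, hR, by linarith⟩
  -- A truncated radial field, whose divergence is a positive constant on `Ω`.
  let φ : EuclideanSpace ℝ (Fin N) → EuclideanSpace ℝ (Fin N) := fun x => ((R + 1)⁻¹ * f x) • x
  have hφ1 : ContDiff ℝ 1 φ := (contDiff_const.mul f.contDiff).smul contDiff_id
  have hφ2 : HasCompactSupport φ := f.hasCompactSupport.mul_left.smul_right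
  have hφ3 : ∀ x, ‖φ x‖ ≤ 1 := by
    intro x
    by_cases hx : ‖x‖ < R + 1
    · rw [norm_smul, norm_mul, norm_inv, Real.norm_of_nonneg (by positivity : 0 ≤ R + 1),
        Real.norm_of_nonneg f.nonneg]
      have h1 : f x ≤ 1 := f.le_one
      calc (R + 1)⁻¹ * f x * ‖x‖ ≤ (R + 1)⁻¹ * 1 * (R + 1) := by gcongr
        _ = 1 := by field_simp
    · have : f x = 0 := f.zero_of_le_dist (by simpa [f] using hx)
      simp [φ, this]
  have hdiv : ∀ x ∈ Ω, divergence φ x = (R + 1)⁻¹ * N := by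
    intro x hx
    have hev : φ =ᶠ[𝓝 x] fun y => (R + 1)⁻¹ • y := by
      filter_upwards [Metric.isOpen_ball.mem_nhds (hΩR hx)] with y hy
      have : f y = 1 := f.one_of_mem_closedBall (Metric.ball_subset_closedBall hy)
      simp [φ, this]
    have hfd : fderiv ℝ φ x = (R + 1)⁻¹ • ContinuousLinearMap.id ℝ _ := by
      rw [hev.fderiv_eq, fderiv_fun_const_smul differentiableAt_fun_id, fderiv_fun_id]
    simp [divergence, hfd, mul_comm]
  have hint : ∫ x, Ω.indicator (fun _ => (1 : ℝ)) x * divergence φ x =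
      (R + 1)⁻¹ * N * volume.real Ω := by
    have : (fun x => Ω.indicator (fun _ => (1 : ℝ)) x * divergence φ x) =
        Ω.indicator fun _ => (R + 1)⁻¹ * N := by
      ext x
      by_cases hx : x ∈ Ω <;> simp [hx, hdiv]
    rw [this, integral_indicator_const _ hΩ.measurableSet, smul_eq_mul, mul_comm]
  refine lt_of_lt_of_le ?_ (enorm_integral_mul_divergence_le _ hφ1 hφ2 hφ3)
  rw [hint, enorm_pos]
  have hN' : (0 : ℝ) < N := by exact_mod_cast hN
  have hvol : 0 < volume.real Ω :=
    ENNReal.toReal_pos (hΩ.measure_pos volume hne).ne' hb.measure_lt_top.ne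
  positivity

theorem tendsto_mul_nuMeasure_of_tendsto (hN : 1 ≤ N) {Ω : Set (EuclideanSpace ℝ (Fin N))}
    (hΩ : IsOpen Ω) (hb : Bornology.IsBounded Ω) {γ : ℝ} (hγ : γ ≠ -1)
    {e : EuclideanSpace ℝ (Fin N)} (he : ‖e‖ = 1) {l : Filter ℝ} (hpos : ∀ᶠ t in l, 0 < t)
    (hl : Tendsto (fun t : ℝ => t ^ (-(1 + γ))⁻¹) l (𝓝 0)) :
    Tendsto (fun t : ℝ => ENNReal.ofReal t *
        nuMeasure N γ (superlevelSet t γ (Ω.indicator fun _ => 1))) l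
      (𝓝 (ENNReal.ofReal (kappa 1 e / |γ + 1|) * gradVariation (Ω.indicator fun _ => 1))) := by
  have hl' : Tendsto (fun t : ℝ => t ^ (-(1 + γ))⁻¹) l (𝓝[>] 0) :=
    tendsto_nhdsWithin_iff.2 ⟨hl, hpos.mono fun t ht => Real.rpow_pos_of_pos ht _⟩
  refine ((tendsto_translationEnergy_indicator hN hΩ hb hγ he).comp hl').congr' ?_
  filter_upwards [hpos] with t ht
  have hne : -(1 + γ) ≠ 0 := fun h => hγ (by linarith)
  have h := mul_nuMeasure_superlevelSet hΩ.measurableSet γ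
    (Real.rpow_pos_of_pos ht (-(1 + γ))⁻¹)
  rw [← Real.rpow_mul ht.le, inv_mul_cancel₀ hne, Real.rpow_one] at h
  exact h.symm

theorem tendsto_mul_nuMeasure_atTop (hN : 1 ≤ N) {Ω : Set (EuclideanSpace ℝ (Fin N))}
    (hΩ : IsOpen Ω) (hb : Bornology.IsBounded Ω) {γ : ℝ} (hγ : -1 < γ)
    {e : EuclideanSpace ℝ (Fin N)} (he : ‖e‖ = 1) :
    Tendsto (fun t : ℝ => ENNReal.ofReal t *
        nuMeasure N γ (superlevelSet t γ (Ω.indicator fun _ => 1))) atTop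
      (𝓝 (ENNReal.ofReal (kappa 1 e / |γ + 1|) * gradVariation (Ω.indicator fun _ => 1))) := by
  refine tendsto_mul_nuMeasure_of_tendsto hN hΩ hb hγ.ne' he (eventually_gt_atTop 0) ?_
  rw [inv_neg]
  exact tendsto_rpow_neg_atTop (inv_pos.2 (by linarith))

theorem tendsto_mul_nuMeasure_nhdsGT_zero (hN : 1 ≤ N) {Ω : Set (EuclideanSpace ℝ (Fin N))}
    (hΩ : IsOpen Ω) (hb : Bornology.IsBounded Ω) {γ : ℝ} (hγ : γ < -1)
    {e : EuclideanSpace ℝ (Fin N)} (he : ‖e‖ = 1) :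
    Tendsto (fun t : ℝ => ENNReal.ofReal t *
        nuMeasure N γ (superlevelSet t γ (Ω.indicator fun _ => 1))) (𝓝[>] 0)
      (𝓝 (ENNReal.ofReal (kappa 1 e / |γ + 1|) * gradVariation (Ω.indicator fun _ => 1))) := by
  refine tendsto_mul_nuMeasure_of_tendsto hN hΩ hb hγ.ne he self_mem_nhdsWithin ?_
  have hexp : 0 < (-(1 + γ))⁻¹ := inv_pos.2 (by linarith)
  have h := (Real.continuousAt_rpow_const 0 _ (Or.inr hexp.le)).tendsto
  rw [Real.zero_rpow hexp.ne'] at h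
  exact h.mono_left nhdsWithin_le_nhds

theorem translationDefect_indicator_le_two_mul {Ω : Set (EuclideanSpace ℝ (Fin N))}
    (hΩ : IsOpen Ω) (h : EuclideanSpace ℝ (Fin N)) :
    translationDefect (Ω.indicator fun _ => 1) h ≤ 2 * volume Ω := by
  rw [two_mul]
  exact (translationDefect_indicator_le hΩ h).trans
    (add_le_add (measure_mono fun x hx => hx.1) (measure_mono fun x hx => hx.1))

/-- A bound free of `t`: the first term dominates for `‖h‖ < 1`. For `‖h‖ > 1` one power of `‖h‖` is
split off, so that the exponent `γ - 1 < -1` puts the support of the kernel outside the unit ball.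
-/
theorem jumpKernel_le_add {γ : ℝ} (hγ : -1 < γ) (hγ0 : γ < 0) (t : ℝ)
    {h : EuclideanSpace ℝ (Fin N)} (h0 : h ≠ 0) (h1 : ‖h‖ ≠ 1) :
    jumpKernel N γ t h ≤ jumpKernel N γ 1 h + jumpKernel N (γ - 1) 1 h * ‖h‖ₑ := by
  have hpos : 0 < ‖h‖ := norm_pos_iff.2 h0
  have hle : jumpKernel N γ t h ≤ ENNReal.ofReal (‖h‖ ^ (γ - (N : ℝ))) := by
    unfold jumpKernel
    split_ifs <;> simp
  refine hle.trans ?_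
  rcases lt_or_gt_of_ne h1 with hlt | hgt
  · have : 1 * ‖h‖ ^ (1 + γ) < 1 := by
      rw [one_mul]
      exact Real.rpow_lt_one hpos.le hlt (by linarith)
    rw [jumpKernel, if_pos this]
    exact le_self_add
  · have : 1 * ‖h‖ ^ (1 + (γ - 1)) < 1 := by
      rw [one_mul]
      exact Real.rpow_lt_one_of_one_lt_of_neg hgt (by linarith)
    rw [jumpKernel, jumpKernel, if_pos this, ← ofReal_norm h, ← ENNReal.ofReal_mul (by positivity),
      ← Real.rpow_add_one hpos.ne']
    refine le_of_eq_of_le ?_ le_add_self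
    congr 2
    ring

/-- Short displacements are controlled by the variation, through the energy bound at scale `r = 1`.
Long ones are controlled by `2 |Ω|`, the kernel being integrable at infinity because `γ < 0`. -/
theorem exists_nuMeasure_superlevelSet_le (hN : 1 ≤ N) {Ω : Set (EuclideanSpace ℝ (Fin N))}
    (hΩ : IsBoundedSmoothDomain Ω) {γ : ℝ} (hγ : -1 < γ) (hγ0 : γ < 0) :
    ∃ A : ℝ≥0∞, A ≠ ⊤ ∧ ∀ t : ℝ, 0 < t →
      nuMeasure N γ (superlevelSet t γ (Ω.indicator fun _ => 1)) ≤ A := by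
  have := nontrivial_euclideanSpace hN
  obtain ⟨e, he⟩ := exists_norm_eq_one hN
  set u : EuclideanSpace ℝ (Fin N) → ℝ := Ω.indicator fun _ => 1 with hu
  have hum : Measurable u := measurable_const.indicator hΩ.isOpen.measurableSet
  have hT := measurable_translationDefect hum
  have hm := measurable_jumpKernel N γ 1
  have hm' := measurable_jumpKernel N (γ - 1) 1
  have hvol : volume Ω ≠ ⊤ := hΩ.isBounded.measure_lt_top.ne
  have hnear : ∫⁻ h, jumpKernel N γ 1 h * translationDefect u h ≠ ⊤ := by
    have h := translationEnergy_le (isIsotropicWeight_jumpKernel hN hγ.ne' he)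
      (integrable_indicator_of_isBounded hΩ.isOpen hΩ.isBounded)
      (hasCompactSupport_indicator_of_isBounded hΩ.isBounded) one_pos
    simp only [translationEnergy, one_smul, ENNReal.ofReal_one, div_one] at h
    exact ne_top_of_le_ne_top
      (ENNReal.mul_ne_top ENNReal.ofReal_ne_top (gradVariation_indicator_lt_top hN hΩ).ne) h
  have hfar := lintegral_jumpKernel_mul_enorm_ne_top hN (γ := γ - 1) (by linarith)
  refine ⟨(∫⁻ h, jumpKernel N γ 1 h * translationDefect u h) +
    (∫⁻ h, jumpKernel N (γ - 1) 1 h * ‖h‖ₑ) * (2 * volume Ω), by finiteness, fun t ht => ?_⟩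
  rw [nuMeasure_superlevelSet hΩ.isOpen.measurableSet γ ht, ← lintegral_mul_const _ (by fun_prop),
    ← lintegral_add_left (by fun_prop)]
  refine lintegral_mono_ae ?_
  have hae1 : ∀ᵐ h : EuclideanSpace ℝ (Fin N), h ≠ 0 := by
    simp [ae_iff]
  have hae2 : ∀ᵐ h : EuclideanSpace ℝ (Fin N), ‖h‖ ≠ 1 := by
    have := Measure.addHaar_sphere (volume : Measure (EuclideanSpace ℝ (Fin N))) 0 1
    rw [ae_iff]
    convert this using 2
    ext h
    simp
  filter_upwards [hae1, hae2] with h h0 h1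
  calc jumpKernel N γ t h * translationDefect u h
      ≤ (jumpKernel N γ 1 h + jumpKernel N (γ - 1) 1 h * ‖h‖ₑ) * translationDefect u h := by
        gcongr
        exact jumpKernel_le_add hγ hγ0 t h0 h1
    _ ≤ _ := by
        rw [add_mul]
        gcongr
        exact translationDefect_indicator_le_two_mul hΩ.isOpen h

theorem tendsto_ofReal_mul_of_eventually_le {f : ℝ → ℝ≥0∞} {A : ℝ≥0∞} (hA : A ≠ ⊤)
    (hf : ∀ᶠ t in 𝓝[>] (0 : ℝ), f t ≤ A) :
    Tendsto (fun t => ENNReal.ofReal t * f t) (𝓝[>] 0) (𝓝 0) := by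
  have h : Tendsto (fun t : ℝ => ENNReal.ofReal t * A) (𝓝[>] 0) (𝓝 0) := by
    have h1 : Tendsto (fun t : ℝ => ENNReal.ofReal t) (𝓝[>] 0) (𝓝 0) := by
      simpa using (ENNReal.continuous_ofReal.tendsto 0).mono_left nhdsWithin_le_nhds
    simpa using ENNReal.Tendsto.mul_const h1 (Or.inr hA)
  refine tendsto_of_tendsto_of_tendsto_of_le_of_le' tendsto_const_nhds h
    (Eventually.of_forall fun _ => zero_le) ?_
  filter_upwards [hf] with t ht
  gcongr

/-- At `γ = -1` the cutoff reads `t < 1` for every `h`, so the measure is a constant `A` for small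
`t`. Whether `A` is finite need not be decided: `t A` tends to 0 or to `∞`. -/
theorem not_tendsto_mul_nuMeasure_neg_one {Ω : Set (EuclideanSpace ℝ (Fin N))}
    (hΩ : MeasurableSet Ω) {c : ℝ≥0∞} (hc0 : c ≠ 0) (hc : c ≠ ⊤) :
    ¬ Tendsto (fun t : ℝ => ENNReal.ofReal t *
        nuMeasure N (-1) (superlevelSet t (-1) (Ω.indicator fun _ => 1))) (𝓝[>] 0) (𝓝 c) := by
  intro h
  set A := ∫⁻ h : EuclideanSpace ℝ (Fin N), ENNReal.ofReal (‖h‖ ^ (-1 - (N : ℝ))) *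
    translationDefect (Ω.indicator fun _ => 1) h
  have hA : ∀ᶠ t in 𝓝[>] (0 : ℝ),
      nuMeasure N (-1) (superlevelSet t (-1) (Ω.indicator fun _ => 1)) = A := by
    filter_upwards [Ioo_mem_nhdsGT (zero_lt_one (α := ℝ))] with t ht
    rw [nuMeasure_superlevelSet hΩ _ ht.1]
    simp [jumpKernel, ht.2, A]
  rcases eq_or_ne A ⊤ with htop | hfin
  · have h2 : Tendsto (fun t : ℝ => ENNReal.ofReal t *
        nuMeasure N (-1) (superlevelSet t (-1) (Ω.indicator fun _ => 1))) (𝓝[>] 0) (𝓝 ⊤) := by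
      refine tendsto_const_nhds.congr' ?_
      filter_upwards [hA, self_mem_nhdsWithin] with t ht ht0
      rw [ht, htop, ENNReal.mul_top (ENNReal.ofReal_pos.2 ht0).ne']
    exact hc (tendsto_nhds_unique h h2)
  · exact hc0 (tendsto_nhds_unique h
      (tendsto_ofReal_mul_of_eventually_le hfin (hA.mono fun t ht => ht.le)))

theorem ofReal_kappa_mul_eq_iff {e : EuclideanSpace ℝ (Fin N)} (he : ‖e‖ = 1) {V : ℝ≥0∞}
    (hV0 : V ≠ 0) (hV : V ≠ ⊤) {γ : ℝ} (h0 : γ ≠ 0) (h1 : γ ≠ -1) :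
    ENNReal.ofReal (kappa 1 e / |γ + 1|) * V = ENNReal.ofReal (kappa 1 e / |γ|) * V ↔
      γ = -1 / 2 := by
  have hκ := kappa_one_pos he
  have hγ1 : γ + 1 ≠ 0 := fun h => h1 (by linarith)
  rw [ENNReal.mul_left_inj hV0 hV, ENNReal.ofReal_eq_ofReal_iff (by positivity) (by positivity),
    div_eq_div_iff (abs_ne_zero.2 hγ1) (abs_ne_zero.2 h0), mul_right_inj' hκ.ne', eq_comm,
    abs_eq_abs]
  constructor
  · rintro (h | h) <;> linarith
  · intro h
    right
    linarith

theorem isBoundedSmoothDomain_unitBall :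
    IsBoundedSmoothDomain (Metric.ball (0 : EuclideanSpace ℝ (Fin N)) 1) where
  isOpen := Metric.isOpen_ball
  isConnected := ⟨⟨0, by simp⟩, (convex_ball _ _).isPreconnected⟩
  isBounded := Metric.isBounded_ball
  smoothBoundary := by
    intro p hp
    have hp1 : ‖p‖ = 1 := by
      simpa using Metric.frontier_ball_subset_sphere hp
    have hd : HasFDerivAt (fun x : EuclideanSpace ℝ (Fin N) => ‖x‖ ^ 2 - 1)
        (2 • innerSL ℝ p) p := (hasStrictFDerivAt_norm_sq p).hasFDerivAt.sub_const 1
    refine ⟨univ, fun x => ‖x‖ ^ 2 - 1, isOpen_univ, mem_univ p,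
      ((contDiff_norm_sq ℝ).sub contDiff_const).contDiffOn, ?_, ?_⟩
    · rw [hd.fderiv]
      intro h
      have := DFunLike.congr_fun h p
      simp [hp1] at this
    · ext x
      simp only [inter_univ, Metric.mem_ball, dist_zero_right, mem_univ, true_and, mem_ofPred_eq,
        sub_neg]
      rw [sq_lt_one_iff₀ (norm_nonneg x)]

end IndicatorLimits

end

/-! ### The main theorem. -/

theorem proposition1p2 (N : ℕ) (hN : 1 ≤ N) :
    -- the limit formulas fail on the homogeneous BV space, for every `γ ≠ 0`
    ((∀ γ : ℝ, 0 < γ → ∃ u : EuclideanSpace ℝ (Fin N) → ℝ, MemBVDot u ∧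
        ∀ e : EuclideanSpace ℝ (Fin N), ‖e‖ = 1 →
          ¬ Tendsto (fun t : ℝ => ENNReal.ofReal t * nuMeasure N γ (superlevelSet t γ u)) atTop
            (𝓝 (ENNReal.ofReal (kappa 1 e / |γ|) * gradVariation u))) ∧
      (∀ γ : ℝ, γ < 0 → ∃ u : EuclideanSpace ℝ (Fin N) → ℝ, MemBVDot u ∧
        ∀ e : EuclideanSpace ℝ (Fin N), ‖e‖ = 1 →
          ¬ Tendsto (fun t : ℝ => ENNReal.ofReal t * nuMeasure N γ (superlevelSet t γ u)) (𝓝[>] 0)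
            (𝓝 (ENNReal.ofReal (kappa 1 e / |γ|) * gradVariation u)))) ∧
    -- the limits for characteristic functions of bounded smooth domains
    (∀ Ω : Set (EuclideanSpace ℝ (Fin N)), IsBoundedSmoothDomain Ω →
      ∀ u : EuclideanSpace ℝ (Fin N) → ℝ, u = Ω.indicator (fun _ => 1) →
        MemBVDot u ∧
        ∀ e : EuclideanSpace ℝ (Fin N), ‖e‖ = 1 →
          (∀ γ : ℝ, -1 < γ →
            Tendsto (fun t : ℝ => ENNReal.ofReal t * nuMeasure N γ (superlevelSet t γ u)) atTop
              (𝓝 (ENNReal.ofReal (kappa 1 e / |γ + 1|) * gradVariation u))) ∧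
          (∀ γ : ℝ, γ < -1 →
            Tendsto (fun t : ℝ => ENNReal.ofReal t * nuMeasure N γ (superlevelSet t γ u)) (𝓝[>] 0)
              (𝓝 (ENNReal.ofReal (kappa 1 e / |γ + 1|) * gradVariation u))) ∧
          (∀ γ : ℝ, γ ≠ 0 → γ ≠ -1 →
            (ENNReal.ofReal (kappa 1 e / |γ + 1|) * gradVariation u =
                ENNReal.ofReal (kappa 1 e / |γ|) * gradVariation u ↔ γ = -1 / 2))) := by
  have hmem : ∀ Ω : Set (EuclideanSpace ℝ (Fin N)), IsBoundedSmoothDomain Ω →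
      MemBVDot (Ω.indicator fun _ => (1 : ℝ)) := fun Ω hΩ =>
    ⟨(integrable_indicator_of_isBounded hΩ.isOpen hΩ.isBounded).locallyIntegrable,
      gradVariation_indicator_lt_top hN hΩ⟩
  have hpos : ∀ Ω : Set (EuclideanSpace ℝ (Fin N)), IsBoundedSmoothDomain Ω →
      gradVariation (Ω.indicator fun _ => (1 : ℝ)) ≠ 0 := fun Ω hΩ =>
    (gradVariation_indicator_pos hN hΩ.isOpen hΩ.isBounded hΩ.isConnected.nonempty).ne'
  have hball := isBoundedSmoothDomain_unitBall (N := N)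
  -- The counterexample for every `γ` is the indicator of the unit ball; equality of the two
  -- constants would force `γ = -1/2`.
  refine ⟨⟨fun γ hγ => ⟨_, hmem _ hball, fun e he h => ?_⟩,
    fun γ hγ => ⟨_, hmem _ hball, fun e he h => ?_⟩⟩, ?_⟩
  · have h2 := tendsto_mul_nuMeasure_atTop hN hball.isOpen hball.isBounded
      (by linarith : -1 < γ) he
    have := (ofReal_kappa_mul_eq_iff he (hpos _ hball) (hmem _ hball).2.ne hγ.ne'
      (by linarith)).1 (tendsto_nhds_unique h2 h)
    linarith
  · have hκ := kappa_one_pos he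
    have hc0 : ENNReal.ofReal (kappa 1 e / |γ|) *
        gradVariation ((Metric.ball (0 : EuclideanSpace ℝ (Fin N)) 1).indicator fun _ => 1) ≠ 0 :=
      mul_ne_zero (ENNReal.ofReal_pos.2 (div_pos hκ (abs_pos.2 hγ.ne))).ne' (hpos _ hball)
    -- The value `γ = -1/2`, where the constants agree, lies in the last range; there the limit at
    -- `0⁺` is 0, while the claimed value is positive.
    rcases lt_trichotomy γ (-1) with hlt | rfl | hgt
    · have h2 := tendsto_mul_nuMeasure_nhdsGT_zero hN hball.isOpen hball.isBounded hlt he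
      have := (ofReal_kappa_mul_eq_iff he (hpos _ hball) (hmem _ hball).2.ne hγ.ne
        hlt.ne).1 (tendsto_nhds_unique h2 h)
      linarith
    · exact not_tendsto_mul_nuMeasure_neg_one hball.isOpen.measurableSet hc0
        (ENNReal.mul_ne_top ENNReal.ofReal_ne_top (hmem _ hball).2.ne) h
    · obtain ⟨A, hA, hle⟩ := exists_nuMeasure_superlevelSet_le hN hball hgt hγ
      refine hc0 (tendsto_nhds_unique h (tendsto_ofReal_mul_of_eventually_le hA ?_))
      filter_upwards [self_mem_nhdsWithin] with t ht using hle t ht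
  · rintro Ω hΩ u rfl
    exact ⟨hmem Ω hΩ, fun e he =>
      ⟨fun γ hγ => tendsto_mul_nuMeasure_atTop hN hΩ.isOpen hΩ.isBounded hγ he,
        fun γ hγ => tendsto_mul_nuMeasure_nhdsGT_zero hN hΩ.isOpen hΩ.isBounded hγ he,
        fun γ h0 h1 => ofReal_kappa_mul_eq_iff he (hpos Ω hΩ) (hmem Ω hΩ).2.ne h0 h1⟩⟩
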